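/- Let $q_0>0$, $\alpha\in\mathbb R$ and phases $\theta_\pm\in\mathbb R$ with $\theta_++\theta_-\equiv 0 \pmod{2\pi}$, put $q_\pm(t)=q_0e^{i(\alpha t+\theta_\pm)}$, and let $q:\mathbb R\times\mathbb R\to\mathbb C$. Fix $t\in\mathbb R$ and set $$J=\begin{pmatrix}-1&0\\0&1\end{pmatrix},\quad Q(x)=\begin{pmatrix}0&q(x,t)\\ q(-x,-t)&0\end{pmatrix},\quad Q_\pm=\begin{pmatrix}0&q_\pm(t)\\ q_\mp(-t)&0\end{pmatrix}.$$ Let $\mathbb K=\{(k,\lambda)\in\mathbb C^2:\lambda^2=k^2-q_0^2\}$ be the Riemann surface of $\lambda=\sqrt{k^2-q_0^2}$, with upper sheet $\mathbb C_1=\{\Im\lambda>0\}$ and lower sheet $\mathbb C_2=\{\Im\lambda<0\}$, closed sheets $\overline{\mathbb C}_1=\{\Im\lambda\ge0\}$ and $\overline{\mathbb C}_2=\{\Im\lambda\le0\}$, branch points $k=\pm q_0$ (where $\lambda=0$), and cut $\Sigma=\{\Im\lambda=0\}$, i.e. the points over $k\in(-\infty,-q_0]\cup[q_0,\infty)$.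 Let $\phi,\overline\phi,\psi,\overline\psi$ be the solutions of $v_x=(ikJ+Q)v$ with $$\phi\sim\begin{pmatrix}\lambda+k\\ iq_+(-t)\end{pmatrix}e^{-i\lambda x},\quad \overline\phi\sim\begin{pmatrix}-iq_-(t)\\ \lambda+k\end{pmatrix}e^{i\lambda x}\quad (x\to-\infty),$$ $$\psi\sim\begin{pmatrix}-iq_+(t)\\ \lambda+k\end{pmatrix}e^{i\lambda x},\quad \overline\psi\sim\begin{pmatrix}\lambda+k\\ iq_-(-t)\end{pmatrix}e^{-i\lambda x}\quad (x\to+\infty),$$ and, with $W(u,v)=u_1v_2-u_2v_1$, let $$a=\frac{W(\phi,\psi)}{2\lambda(\lambda+k)},\quad \overline a=-\frac{W(\overline\phi,\overline\psi)}{2\lambda(\lambda+k)},\quad b=-\frac{W(\phi,\overline\psi)}{2\lambda(\lambda+k)},\quad \overline b=\frac{W(\overline\phi,\psi)}{2\lambda(\lambda+k)}.$$ Theorem. Suppose that the entries of $Q-Q_-$ are integrable on $(-\infty,0]$ and those of $Q-Q_+$ on $[0,\infty)$. Then the scattering data are well defined: away from the branch points $\phi,\psi$ exist uniquely on $\overline{\mathbb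 C}_1$ and $\overline\phi,\overline\psi$ exist uniquely on $\overline{\mathbb C}_2$, the Wronskian formulas for $a$ and $\overline a$ hold at every $x$, and $\phi=b\psi+a\overline\psi$, $\overline\phi=\overline a\psi+\overline b\,\overline\psi$ on $\Sigma\setminus\{k=\pm q_0\}$. Moreover: (i) $a$ is continuous on $\overline{\mathbb C}_1\setminus\{k=\pm q_0\}$ and analytic on $\mathbb C_1$; $\overline a$ is continuous on $\overline{\mathbb C}_2\setminus\{k=\pm q_0\}$ and analytic on $\mathbb C_2$; $b$ and $\overline b$ are continuous on $\Sigma\setminus\{k=\pm q_0\}$. (ii) If the entries of $Q-Q_-$ and $Q-Q_+$ are, on $(-\infty,0]$ and $[0,\infty)$ respectively, integrable with the weight $(1+|x|)^2$, then $a\lambda$ extends to a continuous function on $\overline{\mathbb C}_1$, analytic on $\mathbb C_1$; $\overline a\lambda$ extends to a continuous function on $\overline{\mathbb C}_2$, analytic on $\mathbb C_2$; and $b\lambda$, $\overline b\lambda$ extend to continuous functions on $\Sigma$ (branch points included). (iii) If for some $c>0$ the entries of $Q-Q_\pm$ are $O(e^{-cx^2})$ as $x\to\pm\infty$ respectively,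 then $a\lambda$, $\overline a\lambda$, $b\lambda$ and $\overline b\lambda$ extend to analytic functions on the whole Riemann surface $\mathbb K$. -/

import Mathlib

open Complex Filter Topology MeasureTheory Asymptotics
open scoped Matrix

namespace RST

/-! ### The Riemann surface of `√(k² - q₀²)` -/

/-- The Riemann surface `𝕂` of `lam = √(k² - q₀²)`: all pairs `(k, lam)` with `lam² = k² - q₀²`, with
the topology induced from `ℂ²`. Two copies of the plane cut along `(-∞, -q₀] ∪ [q₀, ∞)` are glued
along the edges of the cut so that `lam` is continuous through the cut. -/
abbrev Surface (q₀ : ℝ) : Type := {p : ℂ × ℂ // p.2 ^ 2 = p.1 ^ 2 - (q₀ : ℂ) ^ 2}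

namespace Surface

variable {q₀ : ℝ}

/-- The spectral parameter `k` of a point of the surface. -/
def k (p : Surface q₀) : ℂ := p.1.1

/-- The value of `√(k² - q₀²)` at a point of the surface. -/
def lam (p : Surface q₀) : ℂ := p.1.2

end Surface

/-- The open upper sheet `ℂ₁`. -/
def upperSheet (q₀ : ℝ) : Set (Surface q₀) := {p | 0 < p.lam.im}

/-- The closed upper sheet: `ℂ₁` with both edges of its cut and the branch points. -/
def closedUpperSheet (q₀ : ℝ) : Set (Surface q₀) := {p | 0 ≤ p.lam.im}

/-- The open lower sheet `ℂ₂`. -/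
def lowerSheet (q₀ : ℝ) : Set (Surface q₀) := {p | p.lam.im < 0}

/-- The closed lower sheet: `ℂ₂` with both edges of its cut and the branch points. -/
def closedLowerSheet (q₀ : ℝ) : Set (Surface q₀) := {p | p.lam.im ≤ 0}

/-- The branch points `k = ± q₀`. -/
def branchPoints (q₀ : ℝ) : Set (Surface q₀) := {p | p.k = q₀ ∨ p.k = -q₀}

/-- The points of the surface over the cut `(-∞, -q₀] ∪ [q₀, ∞)`, on either of its edges. -/
def cut (q₀ : ℝ) : Set (Surface q₀) := {p | p.k.im = 0 ∧ q₀ ≤ |p.k.re|}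

/-- Analyticity at a point of a function on the surface, as a complex submanifold of `ℂ²`:
near the point the function is the restriction of an analytic function of two variables. -/
def AnalyticAtPoint {q₀ : ℝ} (f : Surface q₀ → ℂ) (p : Surface q₀) : Prop :=
  ∃ F : ℂ × ℂ → ℂ, AnalyticAt ℂ F p.1 ∧ ∀ᶠ p' in 𝓝 p, f p' = F p'.1

/-! ### The scattering problem -/

/-- The constants in the boundary conditions `q(x,t) → q₀ e^{i(αt+θ±)}` as `x → ±∞`, with
`q₀ > 0` and `θ₊ + θ₋ = 0` as phases, that is modulo `2π`. -/
structure Background where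
  q₀ : ℝ
  α : ℝ
  θp : ℝ
  θm : ℝ
  pos : 0 < q₀
  phase : ∃ n : ℤ, θp + θm = 2 * Real.pi * n

namespace Background

/-- `q₊(t) = q₀ e^{i(αt+θ₊)}`. -/
noncomputable def qPlus (B : Background) (t : ℝ) : ℂ := B.q₀ * exp (I * (B.α * t + B.θp))

/-- `q₋(t) = q₀ e^{i(αt+θ₋)}`. -/
noncomputable def qMinus (B : Background) (t : ℝ) : ℂ := B.q₀ * exp (I * (B.α * t + B.θm))

/-- The limit `Q₊(t)` of the potential matrix as `x → +∞`. -/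
noncomputable def QPlus (B : Background) (t : ℝ) : Matrix (Fin 2) (Fin 2) ℂ :=
  !![0, B.qPlus t; B.qMinus (-t), 0]

/-- The limit `Q₋(t)` of the potential matrix as `x → -∞`. -/
noncomputable def QMinus (B : Background) (t : ℝ) : Matrix (Fin 2) (Fin 2) ℂ :=
  !![0, B.qMinus t; B.qPlus (-t), 0]

end Background

/-- The potential matrix `Q` of the reverse space-time Sinh-Gordon equation. -/
def Q (q : ℝ → ℝ → ℂ) (t x : ℝ) : Matrix (Fin 2) (Fin 2) ℂ :=
  !![0, q x t; q (-x) (-t), 0]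

/-- `J = diag(-1, 1)`. -/
def J : Matrix (Fin 2) (Fin 2) ℂ := !![-1, 0; 0, 1]

/-- `v` solves `v_x = (ikJ + Q) v` on `ℝ` at the time `t`. As `Q` is only locally integrable in `x`,
this is read in the sense of Carathéodory: `v` is continuous and the integrated equation holds. -/
def IsSolution (q : ℝ → ℝ → ℂ) (t : ℝ) (k : ℂ) (v : ℝ → Fin 2 → ℂ) : Prop :=
  Continuous v ∧ ∀ x y : ℝ, v y - v x = ∫ s in x..y, ((I * k) • J + Q q t s) *ᵥ v s

/-- The Wronskian `u₁ v₂ - u₂ v₁`. -/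
def wronskian (u v : Fin 2 → ℂ) : ℂ := u 0 * v 1 - u 1 * v 0

/-! ### Decay of the entries of `Q - Q₋` at `-∞` and of `Q - Q₊` at `+∞` -/

/-- The entries of `Q - Q±` are in `L¹`, at the respective end of the line. -/
def L1Decay (B : Background) (q : ℝ → ℝ → ℂ) (t : ℝ) : Prop :=
  ∀ i j : Fin 2,
    IntegrableOn (fun x => (Q q t x - B.QMinus t) i j) (Set.Iic 0) ∧
    IntegrableOn (fun x => (Q q t x - B.QPlus t) i j) (Set.Ici 0)

/-- The entries of `Q - Q±` are in `L^{1,2}`, at the respective end of the line. -/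
def L12Decay (B : Background) (q : ℝ → ℝ → ℂ) (t : ℝ) : Prop :=
  ∀ i j : Fin 2,
    IntegrableOn (fun x => ‖(Q q t x - B.QMinus t) i j‖ * (1 + |x|) ^ 2) (Set.Iic 0) ∧
    IntegrableOn (fun x => ‖(Q q t x - B.QPlus t) i j‖ * (1 + |x|) ^ 2) (Set.Ici 0)

/-- The entries of `Q - Q±` are `O(e^{-c x²})` for some `c > 0`, as `x → ±∞` respectively. -/
def GaussianDecay (B : Background) (q : ℝ → ℝ → ℂ) (t : ℝ) : Prop :=
  ∃ c : ℝ, 0 < c ∧ ∀ i j : Fin 2,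
    (fun x => (Q q t x - B.QMinus t) i j) =O[atBot] (fun x : ℝ => Real.exp (-c * x ^ 2)) ∧
    (fun x => (Q q t x - B.QPlus t) i j) =O[atTop] (fun x : ℝ => Real.exp (-c * x ^ 2))

/-! ### Eigenfunctions -/

section

variable (B : Background) (q : ℝ → ℝ → ℂ) (t : ℝ) (p : Surface B.q₀)

/-- `φ` is a solution with `φ ~ (lam + k, i q₊(-t)) e^{-i lam x}` as `x → -∞`. -/
def IsPhi (φ : ℝ → Fin 2 → ℂ) : Prop :=
  IsSolution q t p.k φ ∧
    Tendsto (fun x : ℝ => exp (I * p.lam * x) • φ x) atBot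
      (𝓝 ![p.lam + p.k, I * B.qPlus (-t)])

/-- `φ` is a solution with `φ ~ (-i q₋(t), lam + k) e^{i lam x}` as `x → -∞`. -/
def IsPhiBar (φ : ℝ → Fin 2 → ℂ) : Prop :=
  IsSolution q t p.k φ ∧
    Tendsto (fun x : ℝ => exp (-(I * p.lam * x)) • φ x) atBot
      (𝓝 ![-(I * B.qMinus t), p.lam + p.k])

/-- `ψ` is a solution with `ψ ~ (-i q₊(t), lam + k) e^{i lam x}` as `x → +∞`. -/
def IsPsi (ψ : ℝ → Fin 2 → ℂ) : Prop :=
  IsSolution q t p.k ψ ∧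
    Tendsto (fun x : ℝ => exp (-(I * p.lam * x)) • ψ x) atTop
      (𝓝 ![-(I * B.qPlus t), p.lam + p.k])

/-- `ψ` is a solution with `ψ ~ (lam + k, i q₋(-t)) e^{-i lam x}` as `x → +∞`. -/
def IsPsiBar (ψ : ℝ → Fin 2 → ℂ) : Prop :=
  IsSolution q t p.k ψ ∧
    Tendsto (fun x : ℝ => exp (I * p.lam * x) • ψ x) atTop
      (𝓝 ![p.lam + p.k, I * B.qMinus (-t)])

/-- The eigenfunction `φ(·, k)`. -/
noncomputable def phi : ℝ → Fin 2 → ℂ := Classical.epsilon (IsPhi B q t p)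

/-- The eigenfunction `φ̄(·, k)`. -/
noncomputable def phiBar : ℝ → Fin 2 → ℂ := Classical.epsilon (IsPhiBar B q t p)

/-- The eigenfunction `ψ(·, k)`. -/
noncomputable def psi : ℝ → Fin 2 → ℂ := Classical.epsilon (IsPsi B q t p)

/-- The eigenfunction `ψ̄(·, k)`. -/
noncomputable def psiBar : ℝ → Fin 2 → ℂ := Classical.epsilon (IsPsiBar B q t p)

/-! ### Scattering data (the Wronskians do not depend on the point, here `x = 0`) -/

/-- `a = W(φ, ψ) / (2 lam (lam + k))`. -/
noncomputable def a : ℂ :=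
  wronskian (phi B q t p 0) (psi B q t p 0) / (2 * p.lam * (p.lam + p.k))

/-- `ā = -W(φ̄, ψ̄) / (2 lam (lam + k))`. -/
noncomputable def aBar : ℂ :=
  -wronskian (phiBar B q t p 0) (psiBar B q t p 0) / (2 * p.lam * (p.lam + p.k))

/-- `b = -W(φ, ψ̄) / (2 lam (lam + k))`. -/
noncomputable def b : ℂ :=
  -wronskian (phi B q t p 0) (psiBar B q t p 0) / (2 * p.lam * (p.lam + p.k))

/-- `b̄ = W(φ̄, ψ) / (2 lam (lam + k))`. -/
noncomputable def bBar : ℂ :=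
  wronskian (phiBar B q t p 0) (psi B q t p 0) / (2 * p.lam * (p.lam + p.k))

/-- The scattering data are well defined at the time `t`: away from the branch points, `φ` and `ψ`
exist and are unique on the closed upper sheet, `φ̄` and `ψ̄` on the closed lower sheet, the
Wronskian formulas for `a` and `ā` hold at every `x`, and over the cut
`φ = b ψ + a ψ̄` and `φ̄ = ā ψ + b̄ ψ̄`. -/
def ScatteringDataWellDefined : Prop :=
  (∀ p ∈ closedUpperSheet B.q₀ \ branchPoints B.q₀,
    (∃! φ, IsPhi B q t p φ) ∧ (∃! ψ, IsPsi B q t p ψ) ∧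
    ∀ x, a B q t p = wronskian (phi B q t p x) (psi B q t p x) / (2 * p.lam * (p.lam + p.k))) ∧
  (∀ p ∈ closedLowerSheet B.q₀ \ branchPoints B.q₀,
    (∃! φ, IsPhiBar B q t p φ) ∧ (∃! ψ, IsPsiBar B q t p ψ) ∧
    ∀ x, aBar B q t p =
      -wronskian (phiBar B q t p x) (psiBar B q t p x) / (2 * p.lam * (p.lam + p.k))) ∧
  (∀ p ∈ cut B.q₀ \ branchPoints B.q₀, ∀ x,
    phi B q t p x = b B q t p • psi B q t p x + a B q t p • psiBar B q t p x ∧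
    phiBar B q t p x = aBar B q t p • psi B q t p x + bBar B q t p • psiBar B q t p x)

end

end RST

/-! ### Primitives of locally integrable functions -/

section Primitive

/-! All four eigenfunctions are instances of one problem at `-∞`: solve `φ' = (iκJ + Q) φ` with
`e^{iμx} φ → v`. For `φ` and `φ̄` take `μ = λ` and `μ = -λ`; the reflection `x ↦ -x`, which replaces
`k` by `-k` and `Q(x)` by `-Q(-x)`, brings `ψ` and `ψ̄` to the same form.

Put `M = e^{iμx} φ`. Then `M' = (N + P) M` with `N = iμ + iκJ + Q₀` constant, `P = Q - Q₀` decaying,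
and `N v = 0`. The phase condition makes the product of the off-diagonal entries of `Q₀` equal to
`q₀²`, so `(iκJ + Q₀)² = -μ²`, that is `N² = 2iμ N` (`leftMatrix_mul_self`). Hence `e^{yN} = 1 +
E(y) N` with `E(y) = (e^{2iμy} - 1)/(2iμ)`, which is entire in `μ` (`expPrimitive`), and `M` is the
Neumann series of `M(x) = v + ∫_{s ≤ x} e^{(x-s)N} P(s) M(s) ds`. The series converges locally
uniformly thanks to factorial bounds, so `M` inherits continuity and analyticity in the parameter
(`VolterraFamily`).

The growth of `E` in `y ≥ 0` separates the three cases. For `Im μ ≥ 0`, `|E| ≤ 1/|μ|`, so integrable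
`P` is enough away from `μ = 0`; also `|E| ≤ y`, which reaches `μ = 0` at the cost of a first moment
of `P`; and for every `μ`, `|E| ≤ y e^{2|μ|y}`, which Gaussian decay absorbs. The link between the
series and the differential equation, with uniqueness, is `isPrimitive_and_tendsto_iff`. It is
needed only for `μ ≠ 0` and `Im μ ≥ 0`; elsewhere the series itself provides the extension.

The coordinate `ζ = λ + k` never vanishes, since `ζ (k - λ) = q₀²`, and `k`, `λ` are holomorphic
functions of `ζ ≠ 0`. So regularity is proved on subsets of `ℂ \ {0}`. Each coefficient is
`W(ζ)/(2λζ)` with `W` a Wronskian of Neumann series at `x = 0`; multiplying by `λ` leaves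
`W(ζ)/(2ζ)`, which is as regular as `W`. -/

theorem MeasureTheory.LocallyIntegrable.intervalIntegrable_volume {E : Type*}
    [NormedAddCommGroup E] {f : ℝ → E} (hf : LocallyIntegrable f volume)
    (a b : ℝ) : IntervalIntegrable f volume a b :=
  intervalIntegrable_iff.mpr <|
    (hf.integrableOn_isCompact isCompact_uIcc).mono_set Set.uIoc_subset_uIcc

theorem locallyIntegrable_of_intervalIntegrable {E : Type*} [NormedAddCommGroup E] {f : ℝ → E}
    (hf : ∀ a b, IntervalIntegrable f volume a b) : LocallyIntegrable f volume := by
  intro x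
  refine ⟨Set.Ioc (x - 1) (x + 1), Ioc_mem_nhds (by linarith) (by linarith), ?_⟩
  exact (intervalIntegrable_iff_integrableOn_Ioc_of_le (by linarith)).1 (hf _ _)

/-- A pairing, bounded by the product of the norms, of a locally integrable and a continuous
function is locally integrable. -/
theorem MeasureTheory.LocallyIntegrable.of_norm_le_mul_continuous {E F G : Type*}
    [NormedAddCommGroup E] [NormedAddCommGroup F] [NormedAddCommGroup G] {f : ℝ → F} {g : ℝ → G} {h : ℝ → E}
    (hf : LocallyIntegrable f volume) (hg : Continuous g) (hm : AEStronglyMeasurable h volume)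
    (hle : ∀ x, ‖h x‖ ≤ ‖f x‖ * ‖g x‖) : LocallyIntegrable h volume := by
  refine (locallyIntegrable_iff).2 fun k hk => ?_
  obtain ⟨C, hC⟩ := hk.exists_bound_of_continuousOn hg.continuousOn
  refine Integrable.mono' ((hf.integrableOn_isCompact hk).norm.mul_const C) hm.restrict ?_
  filter_upwards [ae_restrict_mem hk.measurableSet] with x hx
  exact (hle x).trans (mul_le_mul_of_nonneg_left (hC x hx) (norm_nonneg _))

variable {E : Type*} [NormedAddCommGroup E] [NormedSpace ℝ E]

/-- The function `u'` is locally integrable and `u` is a primitive of it. -/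
structure IsPrimitive (u u' : ℝ → E) : Prop where
  locInt : LocallyIntegrable u' volume
  eq : ∀ x y, u y - u x = ∫ s in x..y, u' s

namespace IsPrimitive

variable {u u' v v' : ℝ → E}

theorem continuous (h : IsPrimitive u u') : Continuous u := by
  have : u = fun x => u 0 + ∫ s in (0 : ℝ)..x, u' s := by
    ext x; rw [← h.eq]; abel
  rw [this]
  exact continuous_const.add
    (intervalIntegral.continuous_primitive (fun a b => h.locInt.intervalIntegrable_volume a b) 0)

theorem add (h : IsPrimitive u u') (h2 : IsPrimitive v v') :
    IsPrimitive (fun x => u x + v x) (fun x => u' x + v' x) := by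
  refine ⟨h.locInt.add h2.locInt, fun x y => ?_⟩
  rw [intervalIntegral.integral_add (h.locInt.intervalIntegrable_volume _ _)
    (h2.locInt.intervalIntegrable_volume _ _), ← h.eq, ← h2.eq]
  abel

theorem neg (h : IsPrimitive u u') : IsPrimitive (fun x => -u x) (fun x => -u' x) := by
  refine ⟨h.locInt.neg, fun x y => ?_⟩
  rw [intervalIntegral.integral_neg, ← h.eq]
  abel

theorem sub (h : IsPrimitive u u') (h2 : IsPrimitive v v') :
    IsPrimitive (fun x => u x - v x) (fun x => u' x - v' x) := by
  simpa [sub_eq_add_neg] using h.add h2.neg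

theorem const (c : E) : IsPrimitive (fun _ => c) (fun _ => 0) :=
  ⟨locallyIntegrable_const _, fun _ _ => by simp⟩

theorem congr (h : IsPrimitive u u') (hv : ∀ x, v x = u x) (hv' : ∀ x, v' x = u' x) :
    IsPrimitive v v' := by
  rwa [show v = u from funext hv, show v' = u' from funext hv']

theorem comp_neg (h : IsPrimitive u u') : IsPrimitive (fun x => u (-x)) (fun x => -u' (-x)) := by
  refine ⟨locallyIntegrable_of_intervalIntegrable fun a b => ?_, fun x y => ?_⟩
  · simpa [Pi.neg_def] using ((h.locInt.intervalIntegrable_volume (-a) (-b)).comp_sub_left 0).neg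
  · rw [h.eq, intervalIntegral.integral_neg, intervalIntegral.integral_comp_neg (fun s => u' s),
      intervalIntegral.integral_symm]

theorem of_hasDerivAt [CompleteSpace E] (hu : ∀ x, HasDerivAt u (u' x) x) (hc : Continuous u') :
    IsPrimitive u u' :=
  ⟨hc.locallyIntegrable, fun _ _ => (intervalIntegral.integral_eq_sub_of_hasDerivAt
    (fun z _ => hu z) (hc.intervalIntegrable _ _)).symm⟩

/-- Increments of `u` are dominated by those of the real primitive of `‖u'‖`, whose absolute
continuity therefore transfers. -/
theorem absolutelyContinuousOnInterval (h : IsPrimitive u u') (a b : ℝ) :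
    AbsolutelyContinuousOnInterval u a b := by
  have hn : IntervalIntegrable (fun s => ‖u' s‖) volume a b :=
    (h.locInt.intervalIntegrable_volume a b).norm
  have H := hn.absolutelyContinuousOnInterval_intervalIntegral (c := a) (by simp)
  refine squeeze_zero (fun _ => Finset.sum_nonneg fun _ _ => dist_nonneg) (fun e => ?_) H
  refine Finset.sum_le_sum fun i _ => ?_
  have hI : ∀ x y, IntervalIntegrable (fun s => ‖u' s‖) volume x y :=
    fun x y => (h.locInt.intervalIntegrable_volume x y).norm
  rw [dist_comm, dist_eq_norm, h.eq, dist_comm (∫ v in a..(e.2 i).1, ‖u' v‖), Real.dist_eq,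
    intervalIntegral.integral_interval_sub_left (hI _ _) (hI _ _)]
  exact intervalIntegral.norm_integral_le_abs_integral_norm

theorem ae_hasDerivAt [CompleteSpace E] (h : IsPrimitive u u') :
    ∀ᵐ x, HasDerivAt u (u' x) x := by
  filter_upwards [LocallyIntegrable.ae_hasDerivAt_integral h.locInt] with x hx
  have : u = fun x => u 0 + ∫ s in (0 : ℝ)..x, u' s := by
    ext x; rw [← h.eq]; abel
  rw [this]
  exact (hx 0).const_add _

/-- The difference between `u` and the integral of `u'` is absolutely continuous with derivative
zero almost everywhere, hence constant. -/
theorem of_absolutelyContinuous [CompleteSpace E]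
    (hac : ∀ a b, AbsolutelyContinuousOnInterval u a b)
    (hd : ∀ᵐ x, HasDerivAt u (u' x) x) (hi : LocallyIntegrable u' volume) : IsPrimitive u u' := by
  refine ⟨hi, fun x y => ?_⟩
  have hI : IsPrimitive (fun z => ∫ s in x..z, u' s) u' := ⟨hi, fun a b => by
    rw [intervalIntegral.integral_interval_sub_left (hi.intervalIntegrable_volume _ _)
      (hi.intervalIntegrable_volume _ _)]⟩
  have hz : ∀ᵐ z, z ∈ Set.uIcc x y → HasDerivAt (u - fun z => ∫ s in x..z, u' s) 0 z := by
    filter_upwards [hd, hI.ae_hasDerivAt] with z h1 h2 _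
    simpa using h1.sub h2
  obtain ⟨C, hC⟩ := ((hac x y).sub
    (hI.absolutelyContinuousOnInterval x y)).const_of_ae_hasDerivAt_zero hz
  have h1 := hC x (by simp)
  have h2 := hC y (by simp)
  simp only [Pi.sub_apply, intervalIntegral.integral_same, sub_zero] at h1 h2
  rw [h1, ← h2]
  abel

end IsPrimitive

/-- Leibniz rule for Carathéodory solutions: products preserve absolute continuity, and the
classical rule holds at almost every point. -/
theorem IsPrimitive.smul {E : Type*} [NormedAddCommGroup E] [NormedSpace ℂ E] [CompleteSpace E]
    {f f' : ℝ → ℂ} {u u' : ℝ → E} (hf : IsPrimitive f f') (hu : IsPrimitive u u') :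
    IsPrimitive (fun x => f x • u x) (fun x => f' x • u x + f x • u' x) := by
  refine .of_absolutelyContinuous (fun a b => (hf.absolutelyContinuousOnInterval a b).fun_smul
    (hu.absolutelyContinuousOnInterval a b)) ?_ ?_
  · filter_upwards [hf.ae_hasDerivAt, hu.ae_hasDerivAt] with x h1 h2
    rw [add_comm]
    exact h1.smul h2
  · refine LocallyIntegrable.add ?_ ?_
    · exact hf.locInt.of_norm_le_mul_continuous hu.continuous
        (hf.locInt.aestronglyMeasurable.smul hu.continuous.aestronglyMeasurable)
        fun x => (norm_smul _ _).le
    · exact hu.locInt.of_norm_le_mul_continuous hf.continuous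
        (hf.continuous.aestronglyMeasurable.smul hu.locInt.aestronglyMeasurable)
        fun x => by rw [norm_smul, mul_comm]

theorem IsPrimitive.mul_real {f f' g g' : ℝ → ℝ} (hf : IsPrimitive f f') (hg : IsPrimitive g g') :
    IsPrimitive (fun x => f x * g x) (fun x => f' x * g x + f x * g' x) := by
  refine .of_absolutelyContinuous (fun a b => (hf.absolutelyContinuousOnInterval a b).fun_mul
    (hg.absolutelyContinuousOnInterval a b)) ?_ ?_
  · filter_upwards [hf.ae_hasDerivAt, hg.ae_hasDerivAt] with x h1 h2
    exact h1.mul h2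
  · refine LocallyIntegrable.add ?_ ?_
    · exact hf.locInt.of_norm_le_mul_continuous hg.continuous
        (hf.locInt.aestronglyMeasurable.mul hg.continuous.aestronglyMeasurable)
        fun x => norm_mul_le _ _
    · exact hg.locInt.of_norm_le_mul_continuous hf.continuous
        (hf.continuous.aestronglyMeasurable.mul hg.locInt.aestronglyMeasurable)
        fun x => by rw [norm_mul, mul_comm]

theorem IsPrimitive.clm {E F : Type*} [NormedAddCommGroup E] [NormedSpace ℂ E] [CompleteSpace E]
    [NormedAddCommGroup F] [NormedSpace ℂ F] [CompleteSpace F]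
    {u u' : ℝ → E} (hu : IsPrimitive u u') (T : E →L[ℂ] F) :
    IsPrimitive (fun x => T (u x)) (fun x => T (u' x)) := by
  refine ⟨fun x => ?_, fun x y => ?_⟩
  · obtain ⟨s, hs, hi⟩ := hu.locInt x
    exact ⟨s, hs, T.integrable_comp hi⟩
  · rw [← map_sub, hu.eq, T.intervalIntegral_comp_comm (hu.locInt.intervalIntegrable_volume _ _)]

theorem IsPrimitive.cexp (c : ℂ) :
    IsPrimitive (fun x : ℝ => exp (c * x)) (fun x : ℝ => c * exp (c * x)) := by
  refine .of_hasDerivAt (fun x => ?_) (by fun_prop)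
  have h : HasDerivAt (fun x : ℝ => c * (x : ℂ)) (c * 1) x :=
    (Complex.ofRealCLM.hasDerivAt (x := x)).const_mul c
  simpa [mul_comm] using h.cexp

theorem IsPrimitive.setIntegral_Iic {E : Type*} [NormedAddCommGroup E] [NormedSpace ℝ E]
    {f : ℝ → E} (hf : ∀ R, IntegrableOn f (Set.Iic R)) :
    IsPrimitive (fun x => ∫ s in Set.Iic x, f s) f := by
  refine ⟨fun x => ⟨Set.Iic (x + 1), Iic_mem_nhds (by linarith), hf _⟩, fun x y => ?_⟩
  exact intervalIntegral.integral_Iic_sub_Iic (hf _) (hf _)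

theorem tendsto_setIntegral_Iic_atBot {E : Type*} [NormedAddCommGroup E] [NormedSpace ℝ E]
    {f : ℝ → E} {R : ℝ} (hf : IntegrableOn f (Set.Iic R)) :
    Tendsto (fun x => ∫ s in Set.Iic x, f s) atBot (𝓝 0) := by
  have h := intervalIntegral_tendsto_integral_Iic R hf tendsto_id
  have h2 : Tendsto (fun x => (∫ s in Set.Iic R, f s) - ∫ s in x..R, f s) atBot (𝓝 0) := by
    simpa using h.const_sub (∫ s in Set.Iic R, f s)
  refine h2.congr' ?_
  filter_upwards [eventually_le_atBot R] with x hx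
  rw [← intervalIntegral.integral_Iic_sub_Iic (hf.mono_set (Set.Iic_subset_Iic.2 hx)) hf]
  abel

end Primitive

/-! ### Volterra equations on a left half-line -/

section Gronwall

theorem IsPrimitive.pow_div_factorial {W w : ℝ → ℝ} (h : IsPrimitive W w) (n : ℕ) :
    IsPrimitive (fun x => W x ^ (n + 1) / (n + 1).factorial)
      (fun x => w x * (W x ^ n / n.factorial)) := by
  induction n with
  | zero => simpa using h
  | succ n ih =>
    -- Uses `W^(n+2)/(n+2)! = (n+2)⁻¹ · W · W^(n+1)/(n+1)!` and the product rule.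
    have hc := (IsPrimitive.const (E := ℝ) (((n + 2 : ℕ) : ℝ)⁻¹)).mul_real (h.mul_real ih)
    refine hc.congr (fun x => ?_) fun x => ?_
    · rw [Nat.factorial_succ (n + 1)]
      push_cast
      field_simp
      try ring
    · rw [Nat.factorial_succ n]
      push_cast
      field_simp
      ring

variable {w : ℝ → ℝ}

theorem setIntegral_Iic_nonneg (h0 : ∀ s, 0 ≤ w s) (x : ℝ) : 0 ≤ ∫ s in Set.Iic x, w s :=
  setIntegral_nonneg measurableSet_Iic fun s _ => h0 s

theorem setIntegral_Iic_le_integral (hw : Integrable w) (h0 : ∀ s, 0 ≤ w s) (x : ℝ) :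
    ∫ s in Set.Iic x, w s ≤ ∫ s, w s :=
  setIntegral_le_integral hw (Eventually.of_forall h0)

theorem isPrimitive_setIntegral_Iic (hw : Integrable w) :
    IsPrimitive (fun x => ∫ s in Set.Iic x, w s) w :=
  .setIntegral_Iic fun _ => hw.integrableOn

theorem integrable_mul_pow_div_factorial (hw : Integrable w) (h0 : ∀ s, 0 ≤ w s) (n : ℕ) :
    Integrable fun s => w s * ((∫ r in Set.Iic s, w r) ^ n / n.factorial) := by
  have hc : Continuous fun s => (∫ r in Set.Iic s, w r) ^ n / (n.factorial : ℝ) :=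
    ((isPrimitive_setIntegral_Iic hw).continuous.pow n).div_const _
  refine Integrable.mul_bdd (c := (∫ s, w s) ^ n / n.factorial) hw hc.aestronglyMeasurable
    (Eventually.of_forall fun s => ?_)
  have h1 := setIntegral_Iic_nonneg h0 s
  have h2 := setIntegral_Iic_le_integral hw h0 s
  rw [Real.norm_of_nonneg (by positivity)]
  gcongr

/-- The integrand is the derivative of `W^(n+1)/(n+1)!`, and the nonnegative value at the lower
endpoint is dropped. This is the source of the factorials in every Neumann bound. -/
theorem setIntegral_mul_pow_div_factorial_le (hw : Integrable w) (h0 : ∀ s, 0 ≤ w s) (n : ℕ)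
    (x : ℝ) :
    ∫ s in Set.Iic x, w s * ((∫ r in Set.Iic s, w r) ^ n / n.factorial) ≤
      (∫ r in Set.Iic x, w r) ^ (n + 1) / (n + 1).factorial := by
  have hp := (isPrimitive_setIntegral_Iic hw).pow_div_factorial n
  refine le_of_tendsto (intervalIntegral_tendsto_integral_Iic x
    (integrable_mul_pow_div_factorial hw h0 n).integrableOn tendsto_id)
    (Eventually.of_forall fun y => ?_)
  rw [id, ← hp.eq]
  have := setIntegral_Iic_nonneg h0 y
  have : 0 ≤ (∫ r in Set.Iic y, w r) ^ (n + 1) / (n + 1).factorial := by positivity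
  linarith

/-- A bounded function dominated by its own Volterra integral vanishes. -/
theorem eq_zero_of_le_setIntegral_Iic {g : ℝ → ℝ} {R C : ℝ} (hw : Integrable w)
    (h0 : ∀ s, 0 ≤ w s) (hg : ∀ x ≤ R, 0 ≤ g x) (hC : ∀ x ≤ R, g x ≤ C)
    (hgm : Continuous g) (hle : ∀ x ≤ R, g x ≤ ∫ s in Set.Iic x, w s * g s) {x : ℝ}
    (hx : x ≤ R) : g x = 0 := by
  have hC0 : 0 ≤ C := (hg x hx).trans (hC x hx)
  -- Feeding the inequality into itself `n` times gains the factor `W^n/n!`, which tends to zero.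
  have key : ∀ n : ℕ, ∀ x ≤ R, g x ≤ C * ((∫ r in Set.Iic x, w r) ^ n / n.factorial) := by
    intro n
    induction n with
    | zero => simpa using hC
    | succ n ih =>
      intro x hx
      refine (hle x hx).trans ?_
      calc ∫ s in Set.Iic x, w s * g s
          ≤ ∫ s in Set.Iic x, C * (w s * ((∫ r in Set.Iic s, w r) ^ n / n.factorial)) := by
            refine setIntegral_mono_on ?_
              ((integrable_mul_pow_div_factorial hw h0 n).const_mul C).integrableOn
              measurableSet_Iic fun s hs => ?_
            · refine Integrable.mul_bdd (c := C) hw.integrableOn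
                hgm.aestronglyMeasurable ?_
              filter_upwards [ae_restrict_mem measurableSet_Iic] with s hs
              rw [Real.norm_of_nonneg (hg s (le_trans hs hx))]
              exact hC s (le_trans hs hx)
            · calc w s * g s ≤ w s * (C * ((∫ r in Set.Iic s, w r) ^ n / n.factorial)) :=
                    mul_le_mul_of_nonneg_left (ih s (le_trans hs hx)) (h0 s)
                _ = _ := by ring
        _ ≤ _ := by
          rw [integral_const_mul]
          exact mul_le_mul_of_nonneg_left (setIntegral_mul_pow_div_factorial_le hw h0 n x) hC0
  refine le_antisymm ?_ (hg x hx)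
  have ht := (FloorSemiring.tendsto_pow_div_factorial_atTop
    (∫ r in Set.Iic x, w r)).const_mul C
  rw [mul_zero] at ht
  exact ge_of_tendsto' ht fun n => key n x hx

end Gronwall

/-! ### Holomorphic dependence of integrals on a parameter -/

section DifferentiableIntegral

/-- A dominated integral of holomorphic functions is holomorphic. -/
theorem differentiableOn_integral_of_dominated {α E : Type*} [MeasurableSpace α] {μ : Measure α}
    [NormedAddCommGroup E] [NormedSpace ℂ E] {U : Set ℂ} (hU : IsOpen U)
    {F : ℂ → α → E} {bound : α → ℝ} (hm : ∀ z ∈ U, AEStronglyMeasurable (F z) μ)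
    (hb : ∀ᵐ a ∂μ, ∀ z ∈ U, ‖F z a‖ ≤ bound a) (hbi : Integrable bound μ)
    (hd : ∀ᵐ a ∂μ, DifferentiableOn ℂ (fun z => F z a) U) :
    DifferentiableOn ℂ (fun z => ∫ a, F z a ∂μ) U := by
  intro z hz
  obtain ⟨r, hr, hrU⟩ := Metric.isOpen_iff.1 hU z hz
  have hsub : ∀ x ∈ Metric.ball z (r / 2), Metric.closedBall x (r / 4) ⊆ U := fun x hx y hy => by
    refine hrU ?_
    rw [Metric.mem_ball] at hx ⊢
    rw [Metric.mem_closedBall] at hy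
    linarith [dist_triangle y x z]
  have hxU : ∀ x ∈ Metric.ball z (r / 2), x ∈ U := fun x hx =>
    hsub x hx (Metric.mem_closedBall_self (by linarith))
  have hz2 : z ∈ Metric.ball z (r / 2) := Metric.mem_ball_self (by linarith)
  refine (hasDerivAt_integral_of_dominated_loc_of_deriv_le
    (F' := fun x a => deriv (fun w => F w a) x) (bound := fun a => bound a / (r / 4))
    (Metric.ball_mem_nhds z (half_pos hr)) ?_ ?_ ?_ ?_ (hbi.div_const _) ?_).2.differentiableAt
      |>.differentiableWithinAt
  · filter_upwards [hU.mem_nhds hz] with x hx using hm x hx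
  · exact hbi.mono' (hm z hz) (hb.mono fun a ha => ha z hz)
  -- Measurability of the derivative in `a`: it is a limit of difference quotients with increments
  -- `1/(n+1)`, started at an index `N` beyond which the shifted points stay in `U`.
  · have hlim : Tendsto (fun n : ℕ => ((1 / ((n : ℝ) + 1) : ℝ) : ℂ)) atTop (𝓝[≠] 0) := by
      refine tendsto_nhdsWithin_iff.2 ⟨?_, Eventually.of_forall fun n => ?_⟩
      · exact_mod_cast (continuous_ofReal.tendsto 0).comp tendsto_one_div_add_atTop_nhds_zero_nat
      · have : (0 : ℝ) < 1 / ((n : ℝ) + 1) := by positivity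
        exact ofReal_ne_zero.2 this.ne'
    have hev : ∀ᶠ n : ℕ in atTop, z + ((1 / ((n : ℝ) + 1) : ℝ) : ℂ) ∈ U := by
      have h0 : Tendsto (fun n : ℕ => z + ((1 / ((n : ℝ) + 1) : ℝ) : ℂ)) atTop (𝓝 (z + 0)) :=
        (tendsto_nhds_of_tendsto_nhdsWithin hlim).const_add z
      rw [add_zero] at h0
      exact h0 (hU.mem_nhds hz)
    obtain ⟨N, hN⟩ := eventually_atTop.1 hev
    refine aestronglyMeasurable_of_tendsto_ae atTop
      (f := fun (n : ℕ) a => ((1 / (((n + N : ℕ) : ℝ) + 1) : ℝ) : ℂ)⁻¹ •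
        (F (z + ((1 / (((n + N : ℕ) : ℝ) + 1) : ℝ) : ℂ)) a - F z a)) (fun n => ?_) ?_
    · exact ((hm _ (hN (n + N) (by omega))).sub (hm z hz)).const_smul _
    · filter_upwards [hd] with a ha
      have := hasDerivAt_iff_tendsto_slope_zero.1
        ((ha z hz).differentiableAt (hU.mem_nhds hz)).hasDerivAt
      exact this.comp (hlim.comp (tendsto_add_atTop_nat N))
  -- Cauchy's estimate on the circle of radius `r/4` bounds the derivative by `bound a / (r/4)`.
  · filter_upwards [hb, hd] with a ha hda x hx
    refine norm_deriv_le_of_forall_mem_sphere_norm_le (by linarith) ?_ fun y hy =>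
      ha y (hsub x hx (Metric.sphere_subset_closedBall hy))
    exact (hda.mono (hsub x hx)).diffContOnCl_ball subset_rfl
  · filter_upwards [hd] with a ha x hx
    exact ((ha x (hxU x hx)).differentiableAt (hU.mem_nhds (hxU x hx))).hasDerivAt

end DifferentiableIntegral

/-! ### Neumann series of Volterra equations depending on a complex parameter -/

section Volterra

variable {E : Type*} [NormedAddCommGroup E] [NormedSpace ℂ E]

/-- The terms of the Neumann series of `u x = v + ∫_{s ≤ x} K x s (u s)`. -/
noncomputable def volterraIter (K : ℝ → ℝ → E →L[ℂ] E) (v : E) : ℕ → ℝ → E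
  | 0 => fun _ => v
  | n + 1 => fun x => ∫ s in Set.Iic x, K x s (volterraIter K v n s)

/-- The solution of `u x = v + ∫_{s ≤ x} K x s (u s)`, as a Neumann series. -/
noncomputable def volterraSol (K : ℝ → ℝ → E →L[ℂ] E) (v : E) (x : ℝ) : E :=
  ∑' n, volterraIter K v n x

/-- A family of Volterra equations, uniformly dominated on the parameter set `S`. -/
structure VolterraFamily (K : ℂ → ℝ → ℝ → E →L[ℂ] E) (v : ℂ → E) (w : ℝ → ℝ → ℝ) (C : ℝ)
    (S : Set ℂ) : Prop where
  meas : ∀ z ∈ S, ∀ x, AEStronglyMeasurable (K z x) volume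
  cont : ∀ s, ContinuousOn (fun p : ℂ × ℝ => K p.1 p.2 s) (S ×ˢ Set.univ)
  contv : ContinuousOn v S
  boundv : ∀ z ∈ S, ‖v z‖ ≤ C
  integrable : ∀ R, Integrable (w R)
  nonneg : ∀ R s, 0 ≤ w R s
  le : ∀ z ∈ S, ∀ R x s, s ≤ x → x ≤ R → ‖K z x s‖ ≤ w R s

namespace VolterraFamily

variable {K : ℂ → ℝ → ℝ → E →L[ℂ] E} {v : ℂ → E} {w : ℝ → ℝ → ℝ} {C : ℝ} {S : Set ℂ}

theorem mono {S' : Set ℂ} (h : VolterraFamily K v w C S) (hS : S' ⊆ S) :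
    VolterraFamily K v w C S' where
  meas z hz := h.meas z (hS hz)
  cont s := (h.cont s).mono (Set.prod_mono hS subset_rfl)
  contv := h.contv.mono hS
  boundv z hz := h.boundv z (hS hz)
  integrable := h.integrable
  nonneg := h.nonneg
  le z hz := h.le z (hS hz)

theorem const_nonneg (h : VolterraFamily K v w C S) {z : ℂ} (hz : z ∈ S) : 0 ≤ C :=
  (norm_nonneg _).trans (h.boundv z hz)

/-- The cutoff `R` is fixed throughout the induction, so the same weight `w R` serves at all points
`s ≤ x ≤ R` of the nested integrals. -/
theorem norm_iter_le (h : VolterraFamily K v w C S) {z : ℂ} (hz : z ∈ S) (n : ℕ) {R x : ℝ}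
    (hx : x ≤ R) : ‖volterraIter (K z) (v z) n x‖ ≤
      C * ((∫ s in Set.Iic x, w R s) ^ n / n.factorial) := by
  induction n generalizing x with
  | zero => simpa [volterraIter] using h.boundv z hz
  | succ n ih =>
    calc ‖volterraIter (K z) (v z) (n + 1) x‖
        ≤ ∫ s in Set.Iic x, C * (w R s * ((∫ r in Set.Iic s, w R r) ^ n / n.factorial)) := by
          refine norm_integral_le_of_norm_le
            ((integrable_mul_pow_div_factorial (h.integrable R) (h.nonneg R) n).const_mul
              C).integrableOn ?_
          filter_upwards [ae_restrict_mem measurableSet_Iic] with s hs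
          calc ‖K z x s (volterraIter (K z) (v z) n s)‖
              ≤ w R s * (C * ((∫ r in Set.Iic s, w R r) ^ n / n.factorial)) :=
                (K z x s).le_of_opNorm_le_of_le (h.le z hz R x s hs hx) (ih (le_trans hs hx))
            _ = _ := by ring
      _ ≤ _ := by
        rw [integral_const_mul]
        exact mul_le_mul_of_nonneg_left
          (setIntegral_mul_pow_div_factorial_le (h.integrable R) (h.nonneg R) n x)
          (h.const_nonneg hz)

theorem norm_iter_le_unif (h : VolterraFamily K v w C S) {z : ℂ} (hz : z ∈ S) (n : ℕ) {R x : ℝ}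
    (hx : x ≤ R) : ‖volterraIter (K z) (v z) n x‖ ≤ C * ((∫ s, w R s) ^ n / n.factorial) := by
  refine (h.norm_iter_le hz n hx).trans ?_
  have := h.const_nonneg hz
  have h1 := setIntegral_Iic_nonneg (h.nonneg R) x
  have h2 := setIntegral_Iic_le_integral (h.integrable R) (h.nonneg R) x
  gcongr

theorem summable_bound (R : ℝ) :
    Summable fun n : ℕ => C * ((∫ s, w R s) ^ n / (n.factorial : ℝ)) :=
  (Real.summable_pow_div_factorial _).mul_left C

theorem hasSum_sol [CompleteSpace E] (h : VolterraFamily K v w C S) {z : ℂ} (hz : z ∈ S) (x : ℝ) :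
    HasSum (fun n => volterraIter (K z) (v z) n x) (volterraSol (K z) (v z) x) :=
  (Summable.of_norm_bounded (summable_bound x)
    fun n => h.norm_iter_le_unif hz n le_rfl).hasSum

/-- The bound for the solution on a left half-line. -/
theorem norm_sol_le (h : VolterraFamily K v w C S) {z : ℂ} (hz : z ∈ S) {R x : ℝ} (hx : x ≤ R) :
    ‖volterraSol (K z) (v z) x‖ ≤ ∑' n : ℕ, C * ((∫ s, w R s) ^ n / (n.factorial : ℝ)) :=
  tsum_of_norm_bounded (summable_bound R).hasSum fun n => h.norm_iter_le_unif hz n hx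

theorem meas_apply (h : VolterraFamily K v w C S) {z : ℂ} (hz : z ∈ S) (x : ℝ) {f : ℝ → E}
    (hf : Continuous f) : AEStronglyMeasurable (fun s => K z x s (f s)) volume :=
  isBoundedBilinearMap_apply.continuous.comp_aestronglyMeasurable
    ((h.meas z hz x).prodMk hf.aestronglyMeasurable)

/-- The domain `s ≤ x` moves with `x`, so it is encoded by an indicator and dominated convergence is
applied on the whole line. The indicator jumps only at `s = x`, a null set; the weight `w (x + 1)`
serves for all nearby points. -/
theorem continuousOn_iter (h : VolterraFamily K v w C S) (n : ℕ) :
    ContinuousOn (fun p : ℂ × ℝ => volterraIter (K p.1) (v p.1) n p.2) (S ×ˢ Set.univ) := by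
  induction n with
  | zero => exact h.contv.comp continuousOn_fst fun p hp => hp.1
  | succ n ih =>
    have hcx : ∀ z ∈ S, Continuous (volterraIter (K z) (v z) n) := fun z hz =>
      continuousOn_univ.1 (ih.comp (f := fun x : ℝ => (z, x)) (by fun_prop)
        fun x _ => ⟨hz, trivial⟩)
    rintro ⟨z, x⟩ ⟨hz, -⟩
    have hx : ∀ᶠ p : ℂ × ℝ in 𝓝[S ×ˢ Set.univ] (z, x), p.2 < x + 1 :=
      (continuous_snd.continuousAt.eventually_lt continuousAt_const (by simp)).filter_mono
        nhdsWithin_le_nhds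
    have hS : ∀ᶠ p : ℂ × ℝ in 𝓝[S ×ˢ Set.univ] (z, x), p.1 ∈ S :=
      eventually_nhdsWithin_of_forall fun p hp => hp.1
    simp only [volterraIter, ← integral_indicator (measurableSet_Iic)]
    refine continuousWithinAt_of_dominated
      (bound := fun s => w (x + 1) s * (C * ((∫ r, w (x + 1) r) ^ n / n.factorial))) ?_ ?_
      ((h.integrable (x + 1)).mul_const _) ?_
    · filter_upwards [hS] with p hp
      exact (h.meas_apply hp p.2 (hcx p.1 hp)).indicator measurableSet_Iic
    · filter_upwards [hS, hx] with p hp hpx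
      refine Eventually.of_forall fun s => ?_
      by_cases hs : s ≤ p.2
      · rw [Set.indicator_of_mem (Set.mem_Iic.2 hs)]
        exact (K p.1 p.2 s).le_of_opNorm_le_of_le (h.le p.1 hp _ _ s hs hpx.le)
          (h.norm_iter_le_unif hp n (hs.trans hpx.le))
      · rw [Set.indicator_of_notMem (by simpa using hs), norm_zero]
        exact mul_nonneg (h.nonneg _ _) ((norm_nonneg _).trans
          (h.norm_iter_le_unif hz n (le_refl (x + 1))))
    · have hne : ∀ᵐ s : ℝ, s ≠ x := by simp [ae_iff, measure_singleton]
      filter_upwards [hne] with s hs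
      rcases lt_or_gt_of_ne hs with hs | hs
      · have hev : ∀ᶠ p : ℂ × ℝ in 𝓝[S ×ˢ Set.univ] (z, x), s < p.2 :=
          (continuousAt_const.eventually_lt continuous_snd.continuousAt (by simpa)).filter_mono
            nhdsWithin_le_nhds
        have hc : ContinuousWithinAt (fun p : ℂ × ℝ => K p.1 p.2 s
            (volterraIter (K p.1) (v p.1) n s)) (S ×ˢ Set.univ) (z, x) := by
          refine (h.cont s (z, x) ⟨hz, trivial⟩).clm_apply ?_
          exact ((ih.comp (f := fun p : ℂ × ℝ => (p.1, s)) (s := S ×ˢ Set.univ)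
            (by fun_prop) fun p hp => ⟨hp.1, trivial⟩) (z, x) ⟨hz, trivial⟩ :)
        refine hc.congr_of_eventuallyEq ?_ ?_
        · filter_upwards [hev] with p hp
          rw [Set.indicator_of_mem (Set.mem_Iic.2 hp.le)]
        · rw [Set.indicator_of_mem (Set.mem_Iic.2 hs.le)]
      · have hev : ∀ᶠ p : ℂ × ℝ in 𝓝[S ×ˢ Set.univ] (z, x), p.2 < s :=
          (continuous_snd.continuousAt.eventually_lt continuousAt_const (by simpa)).filter_mono
            nhdsWithin_le_nhds
        refine (continuousWithinAt_const (b := (0 : E))).congr_of_eventuallyEq ?_ ?_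
        · filter_upwards [hev] with p hp
          rw [Set.indicator_of_notMem (by simpa using hp)]
        · rw [Set.indicator_of_notMem (by simpa using hs)]

theorem continuous_iter (h : VolterraFamily K v w C S) {z : ℂ} (hz : z ∈ S) (n : ℕ) :
    Continuous (volterraIter (K z) (v z) n) :=
  continuousOn_univ.1 ((h.continuousOn_iter n).comp (f := fun x : ℝ => (z, x)) (by fun_prop)
    fun _ _ => ⟨hz, trivial⟩)

theorem continuousOn_sol [CompleteSpace E] (h : VolterraFamily K v w C S) :
    ContinuousOn (fun p : ℂ × ℝ => volterraSol (K p.1) (v p.1) p.2) (S ×ˢ Set.univ) := by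
  rintro ⟨z, x⟩ ⟨hz, -⟩
  have hc : ContinuousOn (fun p : ℂ × ℝ => volterraSol (K p.1) (v p.1) p.2)
      (S ×ˢ Set.Iic (x + 1)) :=
    continuousOn_tsum (fun n => (h.continuousOn_iter n).mono
      (Set.prod_mono subset_rfl (Set.subset_univ _))) (summable_bound (x + 1))
      fun n p hp => h.norm_iter_le_unif hp.1 n hp.2
  refine (hc (z, x) ⟨hz, by simp⟩).mono_of_mem_nhdsWithin ?_
  filter_upwards [self_mem_nhdsWithin, nhdsWithin_le_nhds
    (continuous_snd.continuousAt.eventually_lt (continuousAt_const (y := x + 1)) (by simp))]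
    with p hp hpx
  exact ⟨hp.1, le_of_lt hpx⟩

theorem continuous_sol [CompleteSpace E] (h : VolterraFamily K v w C S) {z : ℂ} (hz : z ∈ S) :
    Continuous (volterraSol (K z) (v z)) :=
  continuousOn_univ.1 (h.continuousOn_sol.comp (f := fun x : ℝ => (z, x)) (by fun_prop)
    fun _ _ => ⟨hz, trivial⟩)

theorem differentiableOn_iter (h : VolterraFamily K v w C S) (hS : IsOpen S)
    (hK : ∀ x s, DifferentiableOn ℂ (fun z => K z x s) S) (hv : DifferentiableOn ℂ v S) (n : ℕ)
    (x : ℝ) : DifferentiableOn ℂ (fun z => volterraIter (K z) (v z) n x) S := by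
  induction n generalizing x with
  | zero => exact hv
  | succ n ih =>
    refine differentiableOn_integral_of_dominated hS
      (bound := fun s => w x s * (C * ((∫ r, w x r) ^ n / n.factorial)))
      (fun z hz => (h.meas_apply hz x (h.continuous_iter hz n)).restrict) ?_
      ((h.integrable x).mul_const _).integrableOn
      (Eventually.of_forall fun s => (hK x s).clm_apply (ih s))
    filter_upwards [ae_restrict_mem measurableSet_Iic] with s hs z hz
    exact (K z x s).le_of_opNorm_le_of_le (h.le z hz _ _ s hs le_rfl)
      (h.norm_iter_le_unif hz n hs)

theorem differentiableOn_sol [CompleteSpace E] (h : VolterraFamily K v w C S) (hS : IsOpen S)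
    (hK : ∀ x s, DifferentiableOn ℂ (fun z => K z x s) S) (hv : DifferentiableOn ℂ v S) (x : ℝ) :
    DifferentiableOn ℂ (fun z => volterraSol (K z) (v z) x) S :=
  differentiableOn_tsum_of_summable_norm (summable_bound x)
    (fun n => h.differentiableOn_iter hS hK hv n x) hS
    fun n _ hz => h.norm_iter_le_unif hz n le_rfl

/-- The integral operator sends each term of the series to the next, so integrating the series
termwise gives it back without its zeroth term `v`. -/
theorem sol_eq [CompleteSpace E] (h : VolterraFamily K v w C S) {z : ℂ} (hz : z ∈ S) (x : ℝ) :
    volterraSol (K z) (v z) x =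
      v z + ∫ s in Set.Iic x, K z x s (volterraSol (K z) (v z) s) := by
  have hsum : HasSum (fun n => ∫ s in Set.Iic x, K z x s (volterraIter (K z) (v z) n s))
      (∫ s in Set.Iic x, K z x s (volterraSol (K z) (v z) s)) := by
    refine hasSum_integral_of_dominated_convergence
      (fun n s => w x s * (C * ((∫ r, w x r) ^ n / n.factorial)))
      (fun n => (h.meas_apply hz x (h.continuous_iter hz n)).restrict) (fun n => ?_)
      (Eventually.of_forall fun s => (summable_bound x).mul_left _) ?_
      (Eventually.of_forall fun s => (K z x s).hasSum (h.hasSum_sol hz s))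
    · filter_upwards [ae_restrict_mem measurableSet_Iic] with s hs
      exact (K z x s).le_of_opNorm_le_of_le (h.le z hz _ _ s hs le_rfl)
        (h.norm_iter_le_unif hz n hs)
    · simp only [tsum_mul_left]
      exact ((h.integrable x).mul_const _).integrableOn
  have h1 := (hasSum_nat_add_iff' 1).2 (h.hasSum_sol hz x)
  have h2 := h1.unique hsum
  simp only [Finset.range_one, Finset.sum_singleton] at h2
  rw [← h2]
  simp [volterraIter]

theorem tendsto_sol [CompleteSpace E] (h : VolterraFamily K v w C S) {z : ℂ} (hz : z ∈ S) :
    Tendsto (volterraSol (K z) (v z)) atBot (𝓝 (v z)) := by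
  rw [tendsto_iff_norm_sub_tendsto_zero]
  have h0 := (tendsto_setIntegral_Iic_atBot (R := 0) (h.integrable 0).integrableOn).mul_const
    (∑' n : ℕ, C * ((∫ s, w 0 s) ^ n / (n.factorial : ℝ)))
  rw [zero_mul] at h0
  refine squeeze_zero' (Eventually.of_forall fun _ => norm_nonneg _) ?_ h0
  filter_upwards [eventually_le_atBot 0] with x hx
  rw [h.sol_eq hz, add_sub_cancel_left, ← integral_mul_const]
  refine norm_integral_le_of_norm_le ((h.integrable 0).mul_const _).integrableOn ?_
  filter_upwards [ae_restrict_mem measurableSet_Iic] with s hs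
  exact (K z x s).le_of_opNorm_le_of_le (h.le z hz _ _ s hs hx)
    (h.norm_sol_le hz (le_trans hs hx))

end VolterraFamily

end Volterra

/-! ### Three bounds for the exponential kernel -/

section ExpKernel

/-- Mean value inequality on the convex half-plane where `|exp| ≤ 1`. -/
theorem norm_exp_sub_one_le_of_re_nonpos {z : ℂ} (hz : z.re ≤ 0) : ‖exp z - 1‖ ≤ ‖z‖ := by
  have hconv : Convex ℝ {w : ℂ | w.re ≤ 0} := convex_halfSpace_re_le 0
  have := hconv.norm_image_sub_le_of_norm_hasDerivWithin_le (f := exp) (f' := exp) (C := 1)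
    (x := 0) (y := z) (fun w _ => (hasDerivAt_exp w).hasDerivWithinAt)
    (fun w hw => by rw [norm_exp]; exact Real.exp_le_one_iff.2 hw) (by simp) hz
  simpa using this

theorem norm_exp_sub_one_le_mul_exp (z : ℂ) : ‖exp z - 1‖ ≤ ‖z‖ * Real.exp ‖z‖ := by
  simpa using norm_exp_sub_sum_le_norm_mul_exp z 1

/-- `∫₀^y e^{2iμr} dr = (e^{2iμy} - 1) / (2iμ)`. -/
noncomputable def expPrimitive (μ : ℂ) (y : ℝ) : ℂ := y * dslope exp 0 (2 * I * μ * y)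

theorem two_I_mul_mul_expPrimitive (μ : ℂ) (y : ℝ) :
    2 * I * μ * expPrimitive μ y = exp (2 * I * μ * y) - 1 := by
  have := sub_smul_dslope exp 0 (2 * I * μ * y)
  rw [sub_zero, smul_eq_mul, exp_zero] at this
  rw [← this, expPrimitive]
  ring

theorem expPrimitive_eq {μ : ℂ} (hμ : μ ≠ 0) (y : ℝ) :
    expPrimitive μ y = (2 * I * μ)⁻¹ * (exp (2 * I * μ * y) - 1) := by
  have h : 2 * I * μ ≠ 0 := by simp [hμ]
  rw [← two_I_mul_mul_expPrimitive, inv_mul_cancel_left₀ h]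

theorem differentiable_dslope_exp : Differentiable ℂ (dslope exp 0) :=
  differentiableOn_univ.1 ((differentiableOn_dslope univ_mem).2 differentiable_exp.differentiableOn)

/-- The condition `1 ≤ c` handles `z = 0`, where the divided slope is the derivative `1`. -/
theorem norm_dslope_exp_le {z : ℂ} {c : ℝ} (hc : 1 ≤ c) (h : ‖exp z - 1‖ ≤ ‖z‖ * c) :
    ‖dslope exp 0 z‖ ≤ c := by
  rcases eq_or_ne z 0 with rfl | hz
  · simpa using hc
  · have := sub_smul_dslope exp 0 z
    rw [sub_zero, smul_eq_mul, exp_zero] at this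
    rw [← this, norm_mul] at h
    exact le_of_mul_le_mul_left h (norm_pos_iff.2 hz)

theorem re_two_I_mul (μ : ℂ) (y : ℝ) : (2 * I * μ * y).re = -(2 * μ.im * y) := by
  simp [mul_assoc]

/-- Uniform up to `μ = 0`, which is what the branch points require; the linear growth costs a moment
of `P`. -/
theorem norm_expPrimitive_le_self {μ : ℂ} (hμ : 0 ≤ μ.im) {y : ℝ} (hy : 0 ≤ y) :
    ‖expPrimitive μ y‖ ≤ y := by
  have h : (2 * I * μ * y).re ≤ 0 := by
    rw [re_two_I_mul, neg_nonpos]; positivity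
  have := norm_dslope_exp_le le_rfl
    ((norm_exp_sub_one_le_of_re_nonpos h).trans_eq (mul_one _).symm)
  rw [expPrimitive, norm_mul, norm_real, Real.norm_of_nonneg hy]
  exact mul_le_of_le_one_right hy this

/-- Bounded in `y`, so that mere integrability of `P` suffices away from the branch points. -/
theorem norm_expPrimitive_le_inv {μ : ℂ} (hμ : 0 ≤ μ.im) (h0 : μ ≠ 0) {y : ℝ} (hy : 0 ≤ y) :
    ‖expPrimitive μ y‖ ≤ ‖μ‖⁻¹ := by
  have h : ‖exp (2 * I * μ * y)‖ ≤ 1 := by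
    rw [norm_exp, re_two_I_mul, Real.exp_le_one_iff, neg_nonpos]; positivity
  have h2 : ‖exp (2 * I * μ * y) - 1‖ ≤ 2 :=
    (norm_sub_le _ _).trans (by rw [norm_one]; linarith)
  rw [expPrimitive_eq h0, norm_mul, norm_inv, norm_mul, norm_mul, norm_I, Complex.norm_ofNat,
    mul_one, mul_inv]
  have : 0 ≤ ‖μ‖⁻¹ := by positivity
  nlinarith

/-- Free of any sign condition on `Im μ`: this carries the continuation across the cut. -/
theorem norm_expPrimitive_le_exp {μ : ℂ} {m : ℝ} (hm : ‖μ‖ ≤ m) {y : ℝ} (hy : 0 ≤ y) :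
    ‖expPrimitive μ y‖ ≤ y * Real.exp (2 * m * y) := by
  have h0 : ‖2 * I * μ * y‖ ≤ 2 * m * y := by
    rw [norm_mul, norm_mul, norm_mul, norm_I, Complex.norm_ofNat, norm_real,
      Real.norm_of_nonneg hy, mul_one]
    gcongr
  have h := norm_dslope_exp_le (Real.one_le_exp (norm_nonneg (2 * I * μ * y)))
    (norm_exp_sub_one_le_mul_exp _)
  rw [expPrimitive, norm_mul, norm_real, Real.norm_of_nonneg hy]
  exact mul_le_mul_of_nonneg_left (h.trans (Real.exp_le_exp.2 h0)) hy

end ExpKernel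

/-! ### The perturbed constant-coefficient system: Volterra kernel and uniqueness -/

section Jost

variable {E : Type*} [NormedAddCommGroup E] [NormedSpace ℂ E]

/-- The kernel of the Volterra equation for the solution `M` of `M' = (N + P) M` with limit `v`
at `-∞`, when `N ^ 2 = 2iμ N`. -/
noncomputable def jostKernel (N : E →L[ℂ] E) (μ : ℂ) (P : ℝ → E →L[ℂ] E) (x s : ℝ) : E →L[ℂ] E :=
  (1 + expPrimitive μ (x - s) • N) * P s

/-- The solution of `M' = (N + P) M` with limit `v` at `-∞`, when `N ^ 2 = 2iμ N`. -/
noncomputable def jostSol (N : E →L[ℂ] E) (μ : ℂ) (P : ℝ → E →L[ℂ] E) (v : E) : ℝ → E :=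
  volterraSol (jostKernel N μ P) v

/-- The factor `1 + n g` bounds `e^{(x-s)N}`, and the monotonicity of `g` replaces `x - s` by `R -
s`, making the weight independent of `x`. -/
theorem volterraFamily_jostKernel {N : ℂ → E →L[ℂ] E} {μ : ℂ → ℂ} {P : ℝ → E →L[ℂ] E}
    {v : ℂ → E} {S : Set ℂ} {n C : ℝ} {g : ℝ → ℝ} (hP : AEStronglyMeasurable P volume)
    (hN : ContinuousOn N S) (hμ : ContinuousOn μ S) (hv : ContinuousOn v S)
    (hn0 : 0 ≤ n) (hn : ∀ z ∈ S, ‖N z‖ ≤ n) (hC : ∀ z ∈ S, ‖v z‖ ≤ C)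
    (hg0 : ∀ y, 0 ≤ y → 0 ≤ g y) (hgm : ∀ a b, 0 ≤ a → a ≤ b → g a ≤ g b)
    (hg : ∀ z ∈ S, ∀ y, 0 ≤ y → ‖expPrimitive (μ z) y‖ ≤ g y)
    (hint : ∀ R, IntegrableOn (fun s => (1 + n * g (R - s)) * ‖P s‖) (Set.Iic R)) :
    VolterraFamily (fun z => jostKernel (N z) (μ z) P) v
      (fun R => (Set.Iic R).indicator fun s => (1 + n * g (R - s)) * ‖P s‖) C S where
  meas z _ x := by
    have hc : Continuous fun s : ℝ => 1 + expPrimitive (μ z) (x - s) • N z := by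
      have := differentiable_dslope_exp.continuous
      unfold expPrimitive
      fun_prop
    exact hc.aestronglyMeasurable.mul hP
  cont s := by
    have h1 : ContinuousOn (fun p : ℂ × ℝ => N p.1) (S ×ˢ Set.univ) :=
      hN.comp continuousOn_fst fun p hp => hp.1
    have h2 : ContinuousOn (fun p : ℂ × ℝ => μ p.1) (S ×ˢ Set.univ) :=
      hμ.comp continuousOn_fst fun p hp => hp.1
    have h3 : ContinuousOn (fun p : ℂ × ℝ => expPrimitive (μ p.1) (p.2 - s)) (S ×ˢ Set.univ) := by
      unfold expPrimitive
      refine ContinuousOn.mul (by fun_prop)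
        (differentiable_dslope_exp.continuous.comp_continuousOn ?_)
      exact (continuousOn_const.mul h2).mul (by fun_prop)
    exact (continuousOn_const.add (h3.smul h1)).mul continuousOn_const
  contv := hv
  boundv := hC
  integrable R := (integrable_indicator_iff measurableSet_Iic).2 (hint R)
  nonneg R s := by
    refine Set.indicator_nonneg (fun s hs => ?_) s
    have := hg0 (R - s) (by simpa using hs)
    positivity
  le z hz R x s hs hx := by
    rw [Set.indicator_of_mem (Set.mem_Iic.2 (hs.trans hx))]
    refine (norm_mul_le _ _).trans (mul_le_mul_of_nonneg_right ?_ (norm_nonneg _))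
    refine (norm_add_le _ _).trans (add_le_add ContinuousLinearMap.norm_id_le ?_)
    rw [norm_smul, mul_comm]
    exact mul_le_mul (hn z hz) ((hg z hz _ (by linarith)).trans
      (hgm _ _ (by linarith) (by linarith))) (norm_nonneg _) hn0

theorem differentiableOn_jostKernel {N : ℂ → E →L[ℂ] E} {μ : ℂ → ℂ} {P : ℝ → E →L[ℂ] E}
    {S : Set ℂ} (hN : DifferentiableOn ℂ N S) (hμ : DifferentiableOn ℂ μ S) (x s : ℝ) :
    DifferentiableOn ℂ (fun z => jostKernel (N z) (μ z) P x s) S := by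
  have h : DifferentiableOn ℂ (fun z => expPrimitive (μ z) (x - s)) S := by
    unfold expPrimitive
    exact (differentiableOn_const _).mul (differentiable_dslope_exp.comp_differentiableOn
      ((hμ.const_mul _).mul_const _))
  exact ((h.smul hN).const_add 1).mul_const (P s)

variable [CompleteSpace E]

/-- The Volterra solution solves the differential equation. -/
theorem isPrimitive_of_volterra {N : E →L[ℂ] E} {μ : ℂ} {P : ℝ → E →L[ℂ] E} {v : E} {M : ℝ → E}
    (hμ : μ ≠ 0) (him : 0 ≤ μ.im) (hN : N * N = (2 * I * μ) • N) (hNv : N v = 0)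
    (hint : ∀ R, IntegrableOn (fun s => P s (M s)) (Set.Iic R))
    (hM : ∀ x, M x = v + ∫ s in Set.Iic x, jostKernel N μ P x s (M s)) :
    IsPrimitive M fun s => N (M s) + P s (M s) := by
  set c : ℂ := 2 * I * μ with hc
  have hc0 : c ≠ 0 := by simp [hc, hμ]
  have hNN : ∀ u, N (N u) = c • N u := fun u => by
    have := congrArg (fun T : E →L[ℂ] E => T u) hN
    simpa using this
  have hintV : ∀ R, IntegrableOn (fun s : ℝ => exp (-c * s) • P s (M s)) (Set.Iic R) := by
    intro R
    refine Integrable.bdd_smul (C := Real.exp (2 * μ.im * R)) (hint R)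
      (by fun_prop) ?_
    filter_upwards [ae_restrict_mem measurableSet_Iic] with s hs
    rw [norm_exp, neg_mul, neg_re, hc, re_two_I_mul, neg_neg, Real.exp_le_exp]
    exact mul_le_mul_of_nonneg_left hs (by positivity)
  -- Splitting `e^{c(x-s)}` into a factor in `x` and a factor in `s` writes `M = v + U + c⁻¹ N
  -- (e^{cx} V - U)` with `U` and `V` plain primitives, to which the product rule applies.
  set U : ℝ → E := fun x => ∫ s in Set.Iic x, P s (M s) with hU
  set V : ℝ → E := fun x => ∫ s in Set.Iic x, exp (-c * s) • P s (M s) with hV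
  have hUp := IsPrimitive.setIntegral_Iic hint
  have hVp := IsPrimitive.setIntegral_Iic hintV
  have hMx : ∀ x : ℝ, M x = v + (U x + (c⁻¹ • N) (exp (c * x) • V x - U x)) := by
    intro x
    have hVs : Integrable (fun s : ℝ => exp (c * x) • (exp (-c * s) • P s (M s)))
        (volume.restrict (Set.Iic x)) := (hintV x).smul (exp (c * x))
    have hW : Integrable (fun s : ℝ => exp (c * x) • (exp (-c * s) • P s (M s)) - P s (M s))
        (volume.restrict (Set.Iic x)) := hVs.sub (hint x)
    rw [hM x, hU, hV]
    simp only
    rw [← integral_smul, ← integral_sub hVs (hint x),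
      ← ContinuousLinearMap.integral_comp_comm _ hW, ← integral_add (hint x)
      ((c⁻¹ • N).integrable_comp hW)]
    congr 2 with s
    change P s (M s) + expPrimitive μ (x - s) • N (P s (M s)) = P s (M s) +
      c⁻¹ • N (exp (c * x) • (exp (-c * s) • P s (M s)) - P s (M s))
    rw [map_sub, map_smul, map_smul]
    rw [expPrimitive_eq hμ, ← hc, smul_smul (exp _), ← Complex.exp_add,
      show c * (x : ℂ) + -c * s = c * ((x - s : ℝ) : ℂ) by push_cast; ring, mul_smul, sub_smul,
      one_smul]
  refine ((IsPrimitive.const v).add (hUp.add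
    ((((IsPrimitive.cexp c).smul hVp).sub hUp).clm (c⁻¹ • N)))).congr hMx fun x => ?_
  have he : exp (c * x) * exp (-c * x) = 1 := by
    rw [← Complex.exp_add, neg_mul, add_neg_cancel, exp_zero]
  -- `N v = 0`, and `N² = cN` makes the two contributions of `U` cancel.
  have hNM : N (M x) = exp (c * x) • N (V x) := by
    rw [hMx x]
    simp only [map_add, map_sub, map_smul, smul_apply, hNv, hNN, smul_smul,
      inv_mul_cancel₀ hc0, one_smul]
    abel_nf
    simp only [mul_assoc, inv_mul_cancel₀ hc0, mul_one]
  have hcV : (c * exp (c * x)) • (c⁻¹ • N) (V x) = exp (c * x) • N (V x) := by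
    rw [smul_apply, smul_smul, mul_right_comm, mul_inv_cancel₀ hc0, one_mul]
  rw [hNM, ← hcV, zero_add, map_sub, map_add, map_smul, map_smul, map_smul, smul_smul, he,
    one_smul]
  abel

theorem exists_bound_of_continuous_of_tendsto_atBot {F : Type*} [NormedAddCommGroup F]
    {f : ℝ → F} {l : F} (hf : Continuous f) (hl : Tendsto f atBot (𝓝 l)) (R : ℝ) :
    ∃ C, ∀ x ≤ R, ‖f x‖ ≤ C := by
  have h1 : ∀ᶠ x in atBot, ‖f x‖ < ‖l‖ + 1 := hl.norm.eventually_lt_const (by linarith)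
  obtain ⟨a, ha⟩ := eventually_atBot.1 h1
  obtain ⟨C, hC⟩ := (isCompact_Icc (a := a) (b := R)).exists_bound_of_continuousOn hf.continuousOn
  refine ⟨max (‖l‖ + 1) C, fun x hx => ?_⟩
  rcases le_total x a with h | h
  · exact (ha x h).le.trans (le_max_left _ _)
  · exact (hC x ⟨h, hx⟩).trans (le_max_right _ _)

/-- A solution of `D' = (N + P) D` that tends to zero at `-∞` vanishes, if `N ^ 2 = 2iμ N` with
`0 ≤ im μ` and `P` is integrable at `-∞`. -/
theorem eq_zero_of_isPrimitive_of_tendsto {N : E →L[ℂ] E} {μ : ℂ} {P : ℝ → E →L[ℂ] E} {D : ℝ → E}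
    (hμ : μ ≠ 0) (him : 0 ≤ μ.im) (hN : N * N = (2 * I * μ) • N)
    (hP : ∀ R, IntegrableOn P (Set.Iic R))
    (hD : IsPrimitive D fun s => N (D s) + P s (D s)) (h0 : Tendsto D atBot (𝓝 0)) (x : ℝ) :
    D x = 0 := by
  set c : ℂ := 2 * I * μ with hc
  have hc0 : c ≠ 0 := by simp [hc, hμ]
  have hNN : ∀ u, N (N u) = c • N u := fun u => by
    have := congrArg (fun T : E →L[ℂ] E => T u) hN
    simpa using this
  -- Since `N² = cN`, `T` is a projection. The unperturbed flow is `e^{cx}` on its range and trivial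
  -- on its kernel; `hY` and `hZ` are the variation of constants formulas on these two parts.
  set T : E →L[ℂ] E := c⁻¹ • N with hT
  have hTN : ∀ u, T (N u) = N u := fun u => by
    rw [hT, smul_apply, hNN, inv_smul_smul₀ hc0]
  have hTc : ∀ u, N u = c • T u := fun u => by
    rw [hT, smul_apply, smul_inv_smul₀ hc0]
  have hPD : ∀ R, IntegrableOn (fun s => ‖P s‖ * ‖D s‖) (Set.Iic R) := by
    intro R
    obtain ⟨C, hC⟩ := exists_bound_of_continuous_of_tendsto_atBot hD.continuous h0 R
    refine Integrable.mul_bdd (c := C) (hP R).norm hD.continuous.norm.aestronglyMeasurable ?_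
    filter_upwards [ae_restrict_mem measurableSet_Iic] with s hs
    rw [norm_norm]
    exact hC s hs
  have hY : IsPrimitive (fun x : ℝ => exp (-c * x) • T (D x))
      (fun x : ℝ => exp (-c * x) • T (P x (D x))) := by
    refine ((IsPrimitive.cexp (-c)).smul (hD.clm T)).congr (fun x => rfl) fun x => ?_
    rw [map_add, hTN, hTc, smul_add, smul_smul, ← add_assoc, ← add_smul]
    rw [show -c * exp (-c * x) + exp (-c * x) * c = 0 by ring, zero_smul, zero_add]
  have hZ : IsPrimitive (fun x => D x - T (D x)) (fun x => P x (D x) - T (P x (D x))) := by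
    refine (hD.sub (hD.clm T)).congr (fun x => rfl) fun x => ?_
    rw [map_add, hTN]
    abel
  set n : ℝ := ‖T‖
  -- The complementary part `D - T D` contributes `1 + n`, the part `T D` contributes `n`, using
  -- `|e^{c(x-s)}| ≤ 1` for `s ≤ x`. Letting `y → -∞` removes the boundary term and leaves a
  -- Gronwall inequality.
  have hstep : ∀ x y : ℝ, y ≤ x → ‖D x‖ ≤ (1 + 2 * n) * ‖D y‖ +
      ∫ s in y..x, (1 + 2 * n) * (‖P s‖ * ‖D s‖) := by
    intro x y hyx
    have hI : IntervalIntegrable (fun s => ‖P s‖ * ‖D s‖) volume y x :=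
      (intervalIntegrable_iff_integrableOn_Ioc_of_le hyx).2
        ((hPD x).mono_set fun s hs => hs.2)
    have he : ∀ s : ℝ, s ≤ x → ‖exp (c * x) * exp (-c * s)‖ ≤ 1 := by
      intro s hs
      rw [← Complex.exp_add, show c * (x : ℂ) + -c * s = 2 * I * μ * ((x - s : ℝ) : ℂ) by
        rw [hc]; push_cast; ring, norm_exp, re_two_I_mul, Real.exp_le_one_iff, neg_nonpos]
      have := sub_nonneg.2 hs
      positivity
    have e1 : D x = (D y - T (D y)) + (∫ s in y..x, (P s (D s) - T (P s (D s)))) +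
        ((exp (c * x) * exp (-c * y)) • T (D y) +
          ∫ s in y..x, (exp (c * x) * exp (-c * s)) • T (P s (D s))) := by
      simp only [mul_smul]
      rw [intervalIntegral.integral_smul, ← hZ.eq, ← hY.eq, ← smul_add,
        add_sub_cancel, add_sub_cancel, smul_smul, ← Complex.exp_add, neg_mul, add_neg_cancel,
        exp_zero]
      simp
    have b1 : ‖D y - T (D y)‖ ≤ (1 + n) * ‖D y‖ := by
      refine (norm_sub_le _ _).trans ?_
      have := T.le_opNorm (D y)
      linarith
    have b2 : ‖∫ s in y..x, (P s (D s) - T (P s (D s)))‖ ≤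
        ∫ s in y..x, (1 + n) * (‖P s‖ * ‖D s‖) := by
      refine intervalIntegral.norm_integral_le_of_norm_le hyx
        (Eventually.of_forall fun s _ => ?_) (hI.const_mul _)
      have h1 := (P s).le_opNorm (D s)
      have h2 := T.le_opNorm_of_le h1
      refine (norm_sub_le _ _).trans ?_
      linarith
    have b3 : ‖(exp (c * x) * exp (-c * y)) • T (D y)‖ ≤ n * ‖D y‖ := by
      rw [norm_smul]
      exact (mul_le_of_le_one_left (norm_nonneg _) (he y hyx)).trans (T.le_opNorm _)
    have b4 : ‖∫ s in y..x, (exp (c * x) * exp (-c * s)) • T (P s (D s))‖ ≤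
        ∫ s in y..x, n * (‖P s‖ * ‖D s‖) := by
      refine intervalIntegral.norm_integral_le_of_norm_le hyx
        (Eventually.of_forall fun s hs => ?_) (hI.const_mul _)
      rw [norm_smul]
      exact (mul_le_of_le_one_left (norm_nonneg _) (he s hs.2)).trans
        (T.le_opNorm_of_le ((P s).le_opNorm (D s)))
    have e2 : ∫ s in y..x, (1 + 2 * n) * (‖P s‖ * ‖D s‖) =
        (∫ s in y..x, (1 + n) * (‖P s‖ * ‖D s‖)) + ∫ s in y..x, n * (‖P s‖ * ‖D s‖) := by
      rw [← intervalIntegral.integral_add (hI.const_mul _) (hI.const_mul _)]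
      congr with s
      ring
    rw [e2]
    calc ‖D x‖ ≤ _ := by
          rw [e1]
          exact (norm_add_le _ _).trans (add_le_add (norm_add_le _ _) (norm_add_le _ _))
      _ ≤ ((1 + n) * ‖D y‖ + ∫ s in y..x, (1 + n) * (‖P s‖ * ‖D s‖)) +
          (n * ‖D y‖ + ∫ s in y..x, n * (‖P s‖ * ‖D s‖)) :=
        add_le_add (add_le_add b1 b2) (add_le_add b3 b4)
      _ = _ := by ring
  have hle : ∀ x, ‖D x‖ ≤ ∫ s in Set.Iic x, (1 + 2 * n) * (‖P s‖ * ‖D s‖) := by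
    intro x
    have h1 := intervalIntegral_tendsto_integral_Iic x ((hPD x).const_mul (1 + 2 * n)) tendsto_id
    have h2 := (h0.norm.const_mul (1 + 2 * n)).add h1
    rw [norm_zero, mul_zero, zero_add] at h2
    refine ge_of_tendsto h2 ?_
    filter_upwards [eventually_le_atBot x] with y hy using hstep x y hy
  obtain ⟨C, hC⟩ := exists_bound_of_continuous_of_tendsto_atBot hD.continuous h0 x
  have hn0 : 0 ≤ n := norm_nonneg _
  refine norm_eq_zero.1 (eq_zero_of_le_setIntegral_Iic (R := x) (C := C) (g := fun s => ‖D s‖)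
    (w := (Set.Iic x).indicator fun s => (1 + 2 * n) * ‖P s‖)
    ((integrable_indicator_iff measurableSet_Iic).2 ((hP x).norm.const_mul _))
    (fun s => Set.indicator_nonneg (fun s _ => by positivity) s) (fun _ _ => norm_nonneg _) hC
    hD.continuous.norm (fun y hy => ?_) le_rfl)
  refine (hle y).trans_eq (setIntegral_congr_fun measurableSet_Iic fun s hs => ?_)
  rw [Set.indicator_of_mem (Set.mem_Iic.2 (le_trans hs hy)), mul_assoc]

end Jost

theorem integrableOn_mul_norm_of_le {F : Type*} [NormedAddCommGroup F] {P : ℝ → F} {a h : ℝ → ℝ}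
    {A R : ℝ} (hP : AEStronglyMeasurable P volume) (ha : Continuous a)
    (h0 : ∀ s ≤ R, 0 ≤ a s) (hle : ∀ s ≤ R, a s ≤ A * h s)
    (hint : IntegrableOn (fun s => h s * ‖P s‖) (Set.Iic R)) :
    IntegrableOn (fun s => a s * ‖P s‖) (Set.Iic R) := by
  refine Integrable.mono' (hint.const_mul A)
    (ha.aestronglyMeasurable.mul hP.norm).restrict ?_
  filter_upwards [ae_restrict_mem measurableSet_Iic] with s hs
  rw [norm_mul, norm_norm, Real.norm_of_nonneg (h0 s hs), ← mul_assoc]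
  exact mul_le_mul_of_nonneg_right (hle s hs) (norm_nonneg _)

/-! ### Parameter regularity of the Volterra solution under the three decay conditions -/

section JostFamily

variable {E : Type*} [NormedAddCommGroup E] [NormedSpace ℂ E]
  {N : ℂ → E →L[ℂ] E} {μ : ℂ → ℂ} {P : ℝ → E →L[ℂ] E} {v : ℂ → E} {T : Set ℂ} {z₀ : ℂ}

/-- Near a point of the parameter set, the Volterra equations are uniformly dominated, provided
that `expPrimitive` is. -/
theorem exists_volterraFamily_jostKernel {g : ℝ → ℝ} (hP : AEStronglyMeasurable P volume)
    (hN : ContinuousOn N T) (hμ : ContinuousOn μ T) (hv : ContinuousOn v T) (hz : z₀ ∈ T)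
    (hg0 : ∀ y, 0 ≤ y → 0 ≤ g y) (hgm : ∀ a b, 0 ≤ a → a ≤ b → g a ≤ g b)
    (hg : ∀ᶠ z in 𝓝[T] z₀, ∀ y, 0 ≤ y → ‖expPrimitive (μ z) y‖ ≤ g y)
    (hint : ∀ n, 0 ≤ n → ∀ R, IntegrableOn (fun s => (1 + n * g (R - s)) * ‖P s‖) (Set.Iic R)) :
    ∃ w C, ∃ S ∈ 𝓝[T] z₀, z₀ ∈ S ∧ S ⊆ T ∧
      VolterraFamily (fun z => jostKernel (N z) (μ z) P) v w C S := by
  have h1 : ∀ᶠ z in 𝓝[T] z₀, ‖N z‖ ≤ ‖N z₀‖ + 1 :=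
    ((hN z₀ hz).norm.eventually_lt_const (lt_add_one _)).mono fun _ h => le_of_lt h
  have h2 : ∀ᶠ z in 𝓝[T] z₀, ‖v z‖ ≤ ‖v z₀‖ + 1 :=
    ((hv z₀ hz).norm.eventually_lt_const (lt_add_one _)).mono fun _ h => le_of_lt h
  have hT : ∀ᶠ z in 𝓝[T] z₀, z ∈ T := eventually_mem_nhdsWithin
  have hall := hT.and (h1.and (h2.and hg))
  refine ⟨_, ‖v z₀‖ + 1, {z | _}, hall, hall.self_of_nhdsWithin hz, fun z h => h.1,
    volterraFamily_jostKernel (n := ‖N z₀‖ + 1) hP (hN.mono fun z h => h.1)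
      (hμ.mono fun z h => h.1) (hv.mono fun z h => h.1) (by positivity) (fun z h => h.2.1)
      (fun z h => h.2.2.1) hg0 hgm (fun z h => h.2.2.2) (hint _ (by positivity))⟩

variable [CompleteSpace E]

theorem continuousWithinAt_jostSol {g : ℝ → ℝ} (hP : AEStronglyMeasurable P volume)
    (hN : ContinuousOn N T) (hμ : ContinuousOn μ T) (hv : ContinuousOn v T) (hz : z₀ ∈ T)
    (hg0 : ∀ y, 0 ≤ y → 0 ≤ g y) (hgm : ∀ a b, 0 ≤ a → a ≤ b → g a ≤ g b)
    (hg : ∀ᶠ z in 𝓝[T] z₀, ∀ y, 0 ≤ y → ‖expPrimitive (μ z) y‖ ≤ g y)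
    (hint : ∀ n, 0 ≤ n → ∀ R, IntegrableOn (fun s => (1 + n * g (R - s)) * ‖P s‖) (Set.Iic R))
    (x : ℝ) : ContinuousWithinAt (fun z => jostSol (N z) (μ z) P (v z) x) T z₀ := by
  obtain ⟨w, C, S, hS, hzS, -, hF⟩ :=
    exists_volterraFamily_jostKernel hP hN hμ hv hz hg0 hgm hg hint
  have h : ContinuousOn (fun z => jostSol (N z) (μ z) P (v z) x) S :=
    hF.continuousOn_sol.comp (f := fun z => (z, x)) (by fun_prop) fun z hz => ⟨hz, trivial⟩
  exact (h z₀ hzS).mono_of_mem_nhdsWithin hS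

theorem differentiableAt_jostSol {g : ℝ → ℝ} (hP : AEStronglyMeasurable P volume)
    (hT : IsOpen T) (hN : DifferentiableOn ℂ N T) (hμ : DifferentiableOn ℂ μ T)
    (hv : DifferentiableOn ℂ v T) (hz : z₀ ∈ T)
    (hg0 : ∀ y, 0 ≤ y → 0 ≤ g y) (hgm : ∀ a b, 0 ≤ a → a ≤ b → g a ≤ g b)
    (hg : ∀ᶠ z in 𝓝[T] z₀, ∀ y, 0 ≤ y → ‖expPrimitive (μ z) y‖ ≤ g y)
    (hint : ∀ n, 0 ≤ n → ∀ R, IntegrableOn (fun s => (1 + n * g (R - s)) * ‖P s‖) (Set.Iic R))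
    (x : ℝ) : DifferentiableAt ℂ (fun z => jostSol (N z) (μ z) P (v z) x) z₀ := by
  obtain ⟨w, C, S, hS, -, hST, hF⟩ := exists_volterraFamily_jostKernel hP hN.continuousOn
    hμ.continuousOn hv.continuousOn hz hg0 hgm hg hint
  rw [hT.nhdsWithin_eq hz] at hS
  have hi : interior S ⊆ T := interior_subset.trans hST
  exact ((hF.mono interior_subset).differentiableOn_sol isOpen_interior
    (fun x s => differentiableOn_jostKernel (hN.mono hi) (hμ.mono hi) x s) (hv.mono hi) x)
    |>.differentiableAt (isOpen_interior.mem_nhds (mem_interior_iff_mem_nhds.2 hS))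

/-- The bound for integrable `P`, away from the zeros of `μ`. -/
theorem eventually_norm_expPrimitive_le_const (hμ : ContinuousOn μ T) (hz : z₀ ∈ T)
    (h0 : μ z₀ ≠ 0) (him : ∀ z ∈ T, 0 ≤ (μ z).im) :
    ∀ᶠ z in 𝓝[T] z₀, ∀ y : ℝ, 0 ≤ y → ‖expPrimitive (μ z) y‖ ≤ (‖μ z₀‖ / 2)⁻¹ := by
  have h1 : 0 < ‖μ z₀‖ := norm_pos_iff.2 h0
  filter_upwards [(hμ z₀ hz).norm.eventually_const_lt (half_lt_self h1),
    eventually_mem_nhdsWithin] with z hz1 hz2 y hy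
  have h3 : 0 < ‖μ z‖ := (half_pos h1).trans hz1
  exact (norm_expPrimitive_le_inv (him z hz2) (norm_pos_iff.1 h3) hy).trans
    (inv_anti₀ (half_pos h1) hz1.le)

theorem continuousOn_jostSol_of_integrable (hP : AEStronglyMeasurable P volume)
    (hPi : ∀ R, IntegrableOn P (Set.Iic R)) (hN : ContinuousOn N T) (hμ : ContinuousOn μ T)
    (hv : ContinuousOn v T) (h0 : ∀ z ∈ T, μ z ≠ 0) (him : ∀ z ∈ T, 0 ≤ (μ z).im) (x : ℝ) :
    ContinuousOn (fun z => jostSol (N z) (μ z) P (v z) x) T := fun z hz =>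
  continuousWithinAt_jostSol (g := fun _ => (‖μ z‖ / 2)⁻¹) hP hN hμ hv hz
    (fun _ _ => by positivity) (fun _ _ _ _ => le_rfl)
    (eventually_norm_expPrimitive_le_const hμ hz (h0 z hz) him)
    (fun _ _ R => (hPi R).norm.const_mul _) x

theorem differentiableOn_jostSol_of_integrable (hP : AEStronglyMeasurable P volume)
    (hPi : ∀ R, IntegrableOn P (Set.Iic R)) (hT : IsOpen T) (hN : DifferentiableOn ℂ N T)
    (hμ : DifferentiableOn ℂ μ T) (hv : DifferentiableOn ℂ v T) (h0 : ∀ z ∈ T, μ z ≠ 0)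
    (him : ∀ z ∈ T, 0 ≤ (μ z).im) (x : ℝ) :
    DifferentiableOn ℂ (fun z => jostSol (N z) (μ z) P (v z) x) T := fun z hz =>
  (differentiableAt_jostSol (g := fun _ => (‖μ z‖ / 2)⁻¹) hP hT hN hμ hv hz
    (fun _ _ => by positivity) (fun _ _ _ _ => le_rfl)
    (eventually_norm_expPrimitive_le_const hμ.continuousOn hz (h0 z hz) him)
    (fun _ _ R => (hPi R).norm.const_mul _) x).differentiableWithinAt

/-- With the kernel bound `g y = y` zeros of `μ` are allowed, so continuity reaches the branch
points. -/
theorem continuousOn_jostSol_of_integrable_weight (hP : AEStronglyMeasurable P volume)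
    (hPi : ∀ R, IntegrableOn (fun s => (1 + |s|) * ‖P s‖) (Set.Iic R)) (hN : ContinuousOn N T)
    (hμ : ContinuousOn μ T) (hv : ContinuousOn v T) (him : ∀ z ∈ T, 0 ≤ (μ z).im) (x : ℝ) :
    ContinuousOn (fun z => jostSol (N z) (μ z) P (v z) x) T := fun z hz => by
  refine continuousWithinAt_jostSol (g := fun y => y) hP hN hμ hv hz
    (fun _ h => h) (fun _ _ _ h => h) ?_ (fun n hn R => ?_) x
  · filter_upwards [eventually_mem_nhdsWithin] with z hz y hy
    exact norm_expPrimitive_le_self (him z hz) hy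
  -- From `R - s ≤ |R| + |s|`: `1 + n (R - s) ≤ (1 + n |R| + n)(1 + |s|)`.
  · refine integrableOn_mul_norm_of_le (A := 1 + n * |R| + n) hP (by fun_prop)
      (fun s hs => ?_) (fun s hs => ?_) (hPi R)
    · have := sub_nonneg.2 hs
      positivity
    · have h1 : n * (R - s) ≤ n * (|R| + |s|) :=
        mul_le_mul_of_nonneg_left (by linarith [le_abs_self R, neg_abs_le s]) hn
      have h2 : 0 ≤ n * |R| * |s| := by positivity
      nlinarith [abs_nonneg s]

theorem differentiableOn_jostSol_of_integrable_exp (hP : AEStronglyMeasurable P volume)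
    (hPi : ∀ c R, IntegrableOn (fun s => Real.exp (c * |s|) * ‖P s‖) (Set.Iic R))
    (hT : IsOpen T) (hN : DifferentiableOn ℂ N T) (hμ : DifferentiableOn ℂ μ T)
    (hv : DifferentiableOn ℂ v T) (x : ℝ) :
    DifferentiableOn ℂ (fun z => jostSol (N z) (μ z) P (v z) x) T := fun z hz => by
  have hm : 0 ≤ ‖μ z‖ + 1 := by positivity
  -- The extra `1` makes `m` a bound for `‖μ‖` on a neighbourhood of `z`.
  set m := ‖μ z‖ + 1 with hm_def
  refine (differentiableAt_jostSol (g := fun y => y * Real.exp (2 * m * y)) hP hT hN hμ hv hz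
    (fun _ h => by positivity) (fun a b ha h => ?_) ?_ (fun n hn R => ?_)
    x).differentiableWithinAt
  · gcongr
    exact ha.trans h
  · filter_upwards [(hμ.continuousOn z hz).norm.eventually_lt_const (lt_add_one _)] with y hy
    exact fun _ => norm_expPrimitive_le_exp (le_of_lt hy)
  -- Since `y ≤ e^y`, `y e^{2my} ≤ e^{(2m+1)y}`; then `R - s ≤ |R| + |s|` separates `R` from `s`.
  · refine integrableOn_mul_norm_of_le (A := 1 + n * Real.exp ((2 * m + 1) * |R|)) hP
      (by fun_prop) (fun s hs => ?_) (fun s hs => ?_) (hPi (2 * m + 1) R)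
    · have := sub_nonneg.2 hs
      positivity
    · have h1 : (R - s) * Real.exp (2 * m * (R - s)) ≤
          Real.exp ((2 * m + 1) * |R|) * Real.exp ((2 * m + 1) * |s|) := by
        calc (R - s) * Real.exp (2 * m * (R - s))
            ≤ Real.exp (R - s) * Real.exp (2 * m * (R - s)) := by
              gcongr
              linarith [Real.add_one_le_exp (R - s)]
          _ = Real.exp ((2 * m + 1) * (R - s)) := by rw [← Real.exp_add]; ring_nf
          _ ≤ Real.exp ((2 * m + 1) * (|R| + |s|)) := by
              gcongr
              linarith [le_abs_self R, neg_abs_le s]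
          _ = _ := by rw [← Real.exp_add]; ring_nf
      have h2 := mul_le_mul_of_nonneg_left h1 hn
      have h3 : 1 ≤ Real.exp ((2 * m + 1) * |s|) := Real.one_le_exp (by positivity)
      linarith

end JostFamily

/-! ### Existence and uniqueness for the problem at `-∞` -/

section JostSolution

variable {E : Type*} [NormedAddCommGroup E] [NormedSpace ℂ E] [CompleteSpace E]

/-- The solution of `φ' = (N - iμ + P) φ` with `e^{iμx} φ x → v` as `x → -∞`. -/
theorem isPrimitive_and_tendsto_iff {N : E →L[ℂ] E} {μ : ℂ} {P : ℝ → E →L[ℂ] E} {v : E}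
    (hμ : μ ≠ 0) (him : 0 ≤ μ.im) (hN : N * N = (2 * I * μ) • N) (hNv : N v = 0)
    (hPm : AEStronglyMeasurable P volume) (hP : ∀ R, IntegrableOn P (Set.Iic R)) (φ : ℝ → E) :
    (IsPrimitive φ (fun s => N (φ s) - (I * μ) • φ s + P s (φ s)) ∧
      Tendsto (fun x : ℝ => exp (I * μ * x) • φ x) atBot (𝓝 v)) ↔
    φ = fun x : ℝ => exp (-(I * μ * x)) • jostSol N μ P v x := by
  -- The parameter plays no role here: the family is constant over the one-point set `{0}`.
  have hg := eventually_norm_expPrimitive_le_const (μ := fun _ => μ) (T := {0}) (z₀ := 0)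
    continuousOn_const rfl hμ (fun _ _ => him)
  obtain ⟨w, C, S, -, hzS, -, hF⟩ := exists_volterraFamily_jostKernel (N := fun _ => N)
    (v := fun _ => v) hPm continuousOn_const continuousOn_const continuousOn_const
    (Set.mem_singleton (0 : ℂ)) (fun _ _ => by positivity) (fun _ _ _ _ => le_rfl) hg
    (fun _ _ R => (hP R).norm.const_mul _)
  have hlim : Tendsto (jostSol N μ P v) atBot (𝓝 v) := hF.tendsto_sol hzS
  have hcont : Continuous (jostSol N μ P v) := hF.continuous_sol hzS
  have hM : IsPrimitive (jostSol N μ P v)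
      fun s => N (jostSol N μ P v s) + P s (jostSol N μ P v s) := by
    refine isPrimitive_of_volterra hμ him hN hNv (fun R => ?_) (hF.sol_eq hzS)
    obtain ⟨C, hC⟩ := exists_bound_of_continuous_of_tendsto_atBot hcont hlim R
    refine Integrable.mono' ((hP R).norm.mul_const C)
      (isBoundedBilinearMap_apply.continuous.comp_aestronglyMeasurable
        (hPm.prodMk hcont.aestronglyMeasurable)).restrict ?_
    filter_upwards [ae_restrict_mem measurableSet_Iic] with s hs
    exact (P s).le_of_opNorm_le_of_le le_rfl (hC s hs)
  have hee : ∀ x : ℝ, exp (I * μ * x) * exp (-(I * μ * x)) = 1 := fun x => by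
    rw [← Complex.exp_add, add_neg_cancel, exp_zero]
  constructor
  · rintro ⟨h1, h2⟩
    have hp : IsPrimitive (fun x : ℝ => exp (I * μ * x) • φ x) fun x : ℝ =>
        N (exp (I * μ * x) • φ x) + P x (exp (I * μ * x) • φ x) := by
      refine ((IsPrimitive.cexp (I * μ)).smul h1).congr (fun _ => rfl) fun x => ?_
      rw [map_smul, map_smul, smul_add, smul_sub, smul_smul, mul_comm (exp _) (I * μ)]
      abel
    have hd := hp.sub hM
    have hz : ∀ x : ℝ, exp (I * μ * x) • φ x - jostSol N μ P v x = 0 :=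
      eq_zero_of_isPrimitive_of_tendsto hμ him hN hP
        (hd.congr (fun _ => rfl) fun x => by simp only [map_sub]; abel)
        (by simpa using h2.sub hlim)
    funext x
    rw [← sub_eq_zero.1 (hz x), smul_smul, mul_comm, hee, one_smul]
  · rintro rfl
    refine ⟨?_, ?_⟩
    · refine ((IsPrimitive.cexp (-(I * μ))).smul hM).congr (fun x => by rw [neg_mul]) fun x => ?_
      rw [map_smul, map_smul, smul_add, smul_smul, neg_mul, neg_mul, neg_smul]
      abel
    · simpa only [smul_smul, hee, one_smul] using hlim

end JostSolution

namespace RST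

/-! ### The two-by-two system with prescribed behaviour at `-∞` -/

section LeftProblem

/-- A matrix as a continuous linear map on `ℂ²`. -/
noncomputable def toCLM (M : Matrix (Fin 2) (Fin 2) ℂ) : (Fin 2 → ℂ) →L[ℂ] (Fin 2 → ℂ) :=
  LinearMap.toContinuousLinearMap M.mulVecLin

theorem toCLM_apply (M : Matrix (Fin 2) (Fin 2) ℂ) (v : Fin 2 → ℂ) : toCLM M v = M *ᵥ v := rfl

/-- The off-diagonal part of the system. -/
noncomputable def offDiag (a b : ℂ) : (Fin 2 → ℂ) →L[ℂ] (Fin 2 → ℂ) := toCLM !![0, a; b, 0]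

theorem offDiag_eq (a b : ℂ) : offDiag a b = a • offDiag 1 0 + b • offDiag 0 1 := by
  ext v i
  fin_cases i <;> simp [offDiag, toCLM_apply]

theorem norm_offDiag_le (a b : ℂ) : ‖offDiag a b‖ ≤ ‖a‖ + ‖b‖ := by
  refine ContinuousLinearMap.opNorm_le_bound _ (by positivity) fun v => ?_
  refine (pi_norm_le_iff_of_nonneg (by positivity)).2 fun i => ?_
  have h0 := norm_le_pi_norm v 0
  have h1 := norm_le_pi_norm v 1
  fin_cases i
  · simp only [offDiag, toCLM_apply, Matrix.mulVec, dotProduct, Fin.sum_univ_two]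
    simp only [Matrix.of_apply, Matrix.cons_val', Matrix.cons_val_zero, Matrix.cons_val_one,
      Fin.zero_eta, zero_mul, zero_add, norm_mul, Matrix.cons_val_fin_one]
    nlinarith [norm_nonneg a, norm_nonneg b, norm_nonneg v]
  · simp only [offDiag, toCLM_apply, Matrix.mulVec, dotProduct, Fin.sum_univ_two]
    simp only [Matrix.of_apply, Matrix.cons_val', Matrix.cons_val_zero, Matrix.cons_val_one,
      Fin.mk_one, zero_mul, add_zero, norm_mul, Matrix.cons_val_fin_one]
    nlinarith [norm_nonneg a, norm_nonneg b, norm_nonneg v]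

/-- `iμ + iκJ + Q₀`, where `Q₀` has the off-diagonal entries `r₀`, `l₀`. -/
noncomputable def leftMatrix (r₀ l₀ κ μ : ℂ) : (Fin 2 → ℂ) →L[ℂ] (Fin 2 → ℂ) :=
  (I * μ) • 1 + (I * κ) • toCLM J + offDiag r₀ l₀

theorem leftMatrix_apply (r₀ l₀ κ μ : ℂ) (v : Fin 2 → ℂ) : leftMatrix r₀ l₀ κ μ v =
    ![(I * μ - I * κ) * v 0 + r₀ * v 1, l₀ * v 0 + (I * μ + I * κ) * v 1] := by
  ext i
  fin_cases i <;>
    simp [leftMatrix, offDiag, toCLM_apply, J, Matrix.vecHead, Matrix.vecTail] <;> ring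

/-- With `A = iκJ + Q₀`, `A² = r₀l₀ - κ² = -μ²`, hence `(A + iμ)² = 2iμ (A + iμ)`. -/
theorem leftMatrix_mul_self {r₀ l₀ κ μ : ℂ} (h : μ ^ 2 = κ ^ 2 - r₀ * l₀) :
    leftMatrix r₀ l₀ κ μ * leftMatrix r₀ l₀ κ μ = (2 * I * μ) • leftMatrix r₀ l₀ κ μ := by
  refine ContinuousLinearMap.ext fun v => ?_
  change leftMatrix r₀ l₀ κ μ (leftMatrix r₀ l₀ κ μ v) = (2 * I * μ) • leftMatrix r₀ l₀ κ μ v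
  simp only [leftMatrix_apply]
  ext i
  fin_cases i
  · simp only [Fin.zero_eta, Matrix.cons_val_zero, Matrix.cons_val_one, Pi.smul_apply, smul_eq_mul,
      Matrix.cons_val_fin_one]
    linear_combination (v 0) * h + (κ ^ 2 - μ ^ 2) * (v 0) * I_sq
  · simp only [Fin.mk_one, Matrix.cons_val_zero, Matrix.cons_val_one, Pi.smul_apply, smul_eq_mul,
      Matrix.cons_val_fin_one]
    linear_combination (v 1) * h + (κ ^ 2 - μ ^ 2) * (v 1) * I_sq

/-- The perturbation of the constant system. -/
noncomputable def leftPert (r l : ℝ → ℂ) (r₀ l₀ : ℂ) (s : ℝ) : (Fin 2 → ℂ) →L[ℂ] (Fin 2 → ℂ) :=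
  offDiag (r s - r₀) (l s - l₀)

/-- `e^{iμx} φ x`, for the solution `φ` of the left problem with the limit `v`. -/
noncomputable def leftJost (r l : ℝ → ℂ) (r₀ l₀ κ μ : ℂ) (v : Fin 2 → ℂ) : ℝ → Fin 2 → ℂ :=
  jostSol (leftMatrix r₀ l₀ κ μ) μ (leftPert r l r₀ l₀) v

/-- `φ` solves `φ' = (iκJ + Q) φ`, where `Q` has the off-diagonal entries `r`, `l`, with
`e^{iμx} φ x → v` as `x → -∞`. -/
def IsLeftSolution (r l : ℝ → ℂ) (κ μ : ℂ) (v : Fin 2 → ℂ) (φ : ℝ → Fin 2 → ℂ) : Prop :=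
  IsPrimitive φ (fun s => ((I * κ) • J + !![0, r s; l s, 0]) *ᵥ φ s) ∧
    Tendsto (fun x : ℝ => exp (I * μ * x) • φ x) atBot (𝓝 v)

/-- The entries are integrable perturbations of their limits at `-∞`, and locally integrable. -/
structure LeftDecay (r l : ℝ → ℂ) (r₀ l₀ : ℂ) : Prop where
  left : ∀ R, IntegrableOn (fun s => r s - r₀) (Set.Iic R)
  right : ∀ R, IntegrableOn (fun s => l s - l₀) (Set.Iic R)

theorem aestronglyMeasurable_of_integrableOn_Iic {F : Type*} [NormedAddCommGroup F] {f : ℝ → F}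
    (h : ∀ R, IntegrableOn f (Set.Iic R)) : AEStronglyMeasurable f volume :=
  LocallyIntegrable.aestronglyMeasurable
    fun x => ⟨Set.Iic (x + 1), Iic_mem_nhds (by linarith), h _⟩

theorem integrableOn_smul_add_smul {F : Type*} [NormedAddCommGroup F] [NormedSpace ℂ F]
    {f g : ℝ → ℂ} {A : Set ℝ} (hf : IntegrableOn f A) (hg : IntegrableOn g A) (u w : F) :
    IntegrableOn (fun s => f s • u + g s • w) A :=
  (hf.smul_const u).add (hg.smul_const w)

namespace LeftDecay

variable {r l : ℝ → ℂ} {r₀ l₀ : ℂ}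

theorem integrableOn (h : LeftDecay r l r₀ l₀) (R : ℝ) :
    IntegrableOn (leftPert r l r₀ l₀) (Set.Iic R) := by
  have : leftPert r l r₀ l₀ =
      fun s => (r s - r₀) • offDiag 1 0 + (l s - l₀) • offDiag 0 1 :=
    funext fun s => offDiag_eq _ _
  rw [this]
  exact integrableOn_smul_add_smul (h.left R) (h.right R) _ _

theorem aestronglyMeasurable (h : LeftDecay r l r₀ l₀) :
    AEStronglyMeasurable (leftPert r l r₀ l₀) volume :=
  aestronglyMeasurable_of_integrableOn_Iic h.integrableOn

theorem isLeftSolution_iff (h : LeftDecay r l r₀ l₀) {κ μ : ℂ} {v : Fin 2 → ℂ} (hμ : μ ≠ 0)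
    (him : 0 ≤ μ.im) (hκ : μ ^ 2 = κ ^ 2 - r₀ * l₀) (hv : leftMatrix r₀ l₀ κ μ v = 0)
    (φ : ℝ → Fin 2 → ℂ) : IsLeftSolution r l κ μ v φ ↔
      φ = fun x : ℝ => exp (-(I * μ * x)) • leftJost r l r₀ l₀ κ μ v x := by
  rw [leftJost, ← isPrimitive_and_tendsto_iff hμ him (leftMatrix_mul_self hκ) hv
    h.aestronglyMeasurable h.integrableOn, IsLeftSolution]
  have : (fun s => ((I * κ) • J + !![0, r s; l s, 0]) *ᵥ φ s) = fun s =>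
      leftMatrix r₀ l₀ κ μ (φ s) - (I * μ) • φ s + leftPert r l r₀ l₀ s (φ s) := by
    funext s
    rw [leftMatrix_apply]
    ext i
    fin_cases i <;>
      simp [leftPert, offDiag, toCLM_apply, J, Matrix.vecHead, Matrix.vecTail] <;> ring
  rw [this]

end LeftDecay

section Family

variable {r l : ℝ → ℂ} {r₀ l₀ : ℂ} {κ μ : ℂ → ℂ} {v : ℂ → Fin 2 → ℂ} {T : Set ℂ}

theorem differentiableOn_leftMatrix (hκ : DifferentiableOn ℂ κ T) (hμ : DifferentiableOn ℂ μ T) :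
    DifferentiableOn ℂ (fun z => leftMatrix r₀ l₀ (κ z) (μ z)) T := by
  unfold leftMatrix
  fun_prop

namespace LeftDecay

theorem continuousOn_leftJost (h : LeftDecay r l r₀ l₀) (hκ : DifferentiableOn ℂ κ T)
    (hμ : DifferentiableOn ℂ μ T) (hv : DifferentiableOn ℂ v T) {S : Set ℂ} (hS : S ⊆ T)
    (h0 : ∀ z ∈ S, μ z ≠ 0) (him : ∀ z ∈ S, 0 ≤ (μ z).im) (x : ℝ) :
    ContinuousOn (fun z => leftJost r l r₀ l₀ (κ z) (μ z) (v z) x) S :=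
  continuousOn_jostSol_of_integrable h.aestronglyMeasurable h.integrableOn
    ((differentiableOn_leftMatrix hκ hμ).continuousOn.mono hS) (hμ.continuousOn.mono hS)
    (hv.continuousOn.mono hS) h0 him x

theorem differentiableOn_leftJost (h : LeftDecay r l r₀ l₀) (hT : IsOpen T)
    (hκ : DifferentiableOn ℂ κ T) (hμ : DifferentiableOn ℂ μ T) (hv : DifferentiableOn ℂ v T)
    (h0 : ∀ z ∈ T, μ z ≠ 0) (him : ∀ z ∈ T, 0 ≤ (μ z).im) (x : ℝ) :
    DifferentiableOn ℂ (fun z => leftJost r l r₀ l₀ (κ z) (μ z) (v z) x) T :=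
  differentiableOn_jostSol_of_integrable h.aestronglyMeasurable h.integrableOn hT
    (differentiableOn_leftMatrix hκ hμ) hμ hv h0 him x

/-- Weighted integrability on any one left half-line passes to all of them, because the compact gap
is covered by local integrability. -/
theorem integrableOn_mul_norm (h : LeftDecay r l r₀ l₀) {g : ℝ → ℝ} (hg : Continuous g)
    (h0 : ∀ s, 0 ≤ g s) {a : ℝ} (hr : IntegrableOn (fun s => ‖r s - r₀‖ * g s) (Set.Iic a))
    (hl : IntegrableOn (fun s => ‖l s - l₀‖ * g s) (Set.Iic a)) (R : ℝ) :
    IntegrableOn (fun s => g s * ‖leftPert r l r₀ l₀ s‖) (Set.Iic R) := by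
  have hm : AEStronglyMeasurable (fun s => g s * ‖leftPert r l r₀ l₀ s‖) volume :=
    hg.aestronglyMeasurable.mul h.aestronglyMeasurable.norm
  have h1 : IntegrableOn (fun s => g s * ‖leftPert r l r₀ l₀ s‖) (Set.Iic a) := by
    refine Integrable.mono' (hr.add hl) hm.restrict (Eventually.of_forall fun s => ?_)
    rw [norm_mul, norm_norm, Real.norm_of_nonneg (h0 s)]
    have := mul_le_mul_of_nonneg_left (norm_offDiag_le (r s - r₀) (l s - l₀)) (h0 s)
    simp only [Pi.add_apply, leftPert]
    linarith
  have h2 : LocallyIntegrable (fun s => g s * ‖leftPert r l r₀ l₀ s‖) volume := by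
    have hP : LocallyIntegrable (leftPert r l r₀ l₀) volume :=
      fun x => ⟨Set.Iic (x + 1), Iic_mem_nhds (by linarith), h.integrableOn _⟩
    refine hP.of_norm_le_mul_continuous hg hm fun s => ?_
    rw [norm_mul, norm_norm, mul_comm]
  refine (h1.union (h2.integrableOn_isCompact (isCompact_Icc (a := a) (b := R)))).mono_set
    fun s hs => ?_
  rcases le_total s a with hsa | hsa
  · exact Or.inl hsa
  · exact Or.inr ⟨hsa, hs⟩

theorem continuousOn_leftJost_of_weight (h : LeftDecay r l r₀ l₀)
    (hr : IntegrableOn (fun s => ‖r s - r₀‖ * (1 + |s|) ^ 2) (Set.Iic 0))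
    (hl : IntegrableOn (fun s => ‖l s - l₀‖ * (1 + |s|) ^ 2) (Set.Iic 0))
    (hκ : DifferentiableOn ℂ κ T) (hμ : DifferentiableOn ℂ μ T) (hv : DifferentiableOn ℂ v T)
    {S : Set ℂ} (hS : S ⊆ T) (him : ∀ z ∈ S, 0 ≤ (μ z).im) (x : ℝ) :
    ContinuousOn (fun z => leftJost r l r₀ l₀ (κ z) (μ z) (v z) x) S := by
  refine continuousOn_jostSol_of_integrable_weight h.aestronglyMeasurable (fun R => ?_)
    ((differentiableOn_leftMatrix hκ hμ).continuousOn.mono hS) (hμ.continuousOn.mono hS)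
    (hv.continuousOn.mono hS) him x
  refine integrableOn_mul_norm_of_le (A := 1) h.aestronglyMeasurable (by fun_prop)
    (fun s _ => by positivity) (fun s _ => ?_)
    (h.integrableOn_mul_norm (g := fun s => (1 + |s|) ^ 2) (by fun_prop)
      (fun s => by positivity) hr hl R)
  nlinarith [abs_nonneg s]

theorem differentiableOn_leftJost_of_gaussian (h : LeftDecay r l r₀ l₀) {c : ℝ} (hc : 0 < c)
    (hr : (fun s => r s - r₀) =O[atBot] fun s : ℝ => Real.exp (-c * s ^ 2))
    (hl : (fun s => l s - l₀) =O[atBot] fun s : ℝ => Real.exp (-c * s ^ 2)) (hT : IsOpen T)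
    (hκ : DifferentiableOn ℂ κ T) (hμ : DifferentiableOn ℂ μ T) (hv : DifferentiableOn ℂ v T)
    (x : ℝ) :
    DifferentiableOn ℂ (fun z => leftJost r l r₀ l₀ (κ z) (μ z) (v z) x) T := by
  have key : ∀ f : ℝ → ℂ, (∀ R, IntegrableOn f (Set.Iic R)) →
      (f =O[atBot] fun s : ℝ => Real.exp (-c * s ^ 2)) → ∀ m : ℝ,
      ∃ a, IntegrableOn (fun s => ‖f s‖ * Real.exp (m * |s|)) (Set.Iic a) := by
    intro f hf hO m
    obtain ⟨C, hC⟩ := hO.bound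
    obtain ⟨a, ha⟩ := eventually_atBot.1 hC
    refine ⟨a, ?_⟩
    -- Completing the square: `m|s| - c s² ≤ m²/(2c) - (c/2) s²`, so a Gaussian absorbs every
    -- exponential rate.
    have hi : Integrable fun s : ℝ =>
        |C| * Real.exp (m ^ 2 / (2 * c)) * Real.exp (-(c / 2) * s ^ 2) :=
      (integrable_exp_neg_mul_sq (half_pos hc)).const_mul _
    refine Integrable.mono' hi.integrableOn
      ((aestronglyMeasurable_of_integrableOn_Iic hf).norm.mul
        (by fun_prop : Continuous fun s : ℝ => Real.exp (m * |s|)).aestronglyMeasurable).restrict ?_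
    filter_upwards [ae_restrict_mem measurableSet_Iic] with s hs
    rw [norm_mul, norm_norm, Real.norm_of_nonneg (Real.exp_nonneg _)]
    have h1 := ha s hs
    rw [Real.norm_of_nonneg (Real.exp_nonneg _)] at h1
    calc ‖f s‖ * Real.exp (m * |s|)
        ≤ (|C| * Real.exp (-c * s ^ 2)) * Real.exp (m * |s|) := by
          gcongr
          exact h1.trans (mul_le_mul_of_nonneg_right (le_abs_self C) (Real.exp_nonneg _))
      _ = |C| * Real.exp (-c * s ^ 2 + m * |s|) := by rw [mul_assoc, ← Real.exp_add]
      _ ≤ |C| * Real.exp (m ^ 2 / (2 * c) + -(c / 2) * s ^ 2) := by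
          refine mul_le_mul_of_nonneg_left (Real.exp_le_exp.2 ?_) (abs_nonneg C)
          have h2 : 0 ≤ (c * |s| - m) ^ 2 / (2 * c) := by positivity
          have h3 : (c * |s| - m) ^ 2 / (2 * c) =
              c / 2 * |s| ^ 2 - m * |s| + m ^ 2 / (2 * c) := by field_simp; ring
          rw [h3, sq_abs] at h2
          linarith
      _ = _ := by rw [Real.exp_add, mul_assoc]
  refine differentiableOn_jostSol_of_integrable_exp h.aestronglyMeasurable (fun m R => ?_) hT
    (differentiableOn_leftMatrix hκ hμ) hμ hv x
  obtain ⟨a, ha⟩ := key _ h.left hr m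
  obtain ⟨b, hb⟩ := key _ h.right hl m
  exact h.integrableOn_mul_norm (a := min a b) (g := fun s => Real.exp (m * |s|)) (by fun_prop)
    (fun s => Real.exp_nonneg _) (ha.mono_set (Set.Iic_subset_Iic.2 (min_le_left _ _)))
    (hb.mono_set (Set.Iic_subset_Iic.2 (min_le_right _ _))) R

end LeftDecay

end Family

end LeftProblem

/-! ### Decay of the potential and of its reflection -/

section Entries

/-- On `[0, R]` the two differences `f - c` and `f - c'` differ by a constant, so decay at `+∞`
supplies what is missing to the right of zero. -/
theorem integrableOn_Iic_of_limits {f : ℝ → ℂ} {c c' : ℂ}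
    (h : IntegrableOn (fun s => f s - c) (Set.Iic 0))
    (h' : IntegrableOn (fun s => f s - c') (Set.Ici 0)) (R : ℝ) :
    IntegrableOn (fun s => f s - c) (Set.Iic R) := by
  have h1 : IntegrableOn (fun s => f s - c) (Set.Icc 0 R) := by
    have h2 : IntegrableOn (fun s => (f s - c') + (c' - c)) (Set.Icc 0 R) :=
      (h'.mono_set Set.Icc_subset_Ici_self).add (continuousOn_const.integrableOn_compact
        isCompact_Icc)
    simpa using h2
  refine (h.union h1).mono_set fun s hs => ?_
  rcases le_total s 0 with h0 | h0
  · exact Or.inl h0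
  · exact Or.inr ⟨h0, hs⟩

theorem integrableOn_Iic_neg_comp_neg {f : ℝ → ℂ} {c : ℂ}
    (h : IntegrableOn (fun s => f s - c) (Set.Ici 0)) :
    IntegrableOn (fun s => -f (-s) - -c) (Set.Iic 0) := by
  rw [← neg_zero] at h
  exact h.comp_neg_Iic.neg.congr_fun (fun s _ => by simp [neg_add_eq_sub]) measurableSet_Iic

theorem integrableOn_Ici_neg_comp_neg {f : ℝ → ℂ} {c : ℂ}
    (h : IntegrableOn (fun s => f s - c) (Set.Iic 0)) :
    IntegrableOn (fun s => -f (-s) - -c) (Set.Ici 0) := by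
  rw [← neg_zero] at h
  exact h.comp_neg_Ici.neg.congr_fun (fun s _ => by simp [neg_add_eq_sub]) measurableSet_Ici

theorem integrableOn_weight_neg_comp_neg {f : ℝ → ℂ} {c : ℂ}
    (h : IntegrableOn (fun s => ‖f s - c‖ * (1 + |s|) ^ 2) (Set.Ici 0)) :
    IntegrableOn (fun s => ‖-f (-s) - -c‖ * (1 + |s|) ^ 2) (Set.Iic 0) := by
  rw [← neg_zero] at h
  have h2 := h.comp_neg_Iic
  refine h2.congr_fun (fun s _ => ?_) measurableSet_Iic
  simp only [abs_neg]
  rw [← norm_neg, neg_sub, sub_neg_eq_add, neg_add_eq_sub]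

theorem isBigO_atBot_neg_comp_neg {f : ℝ → ℂ} {c : ℂ} {a : ℝ}
    (h : (fun s => f s - c) =O[atTop] fun s : ℝ => Real.exp (-a * s ^ 2)) :
    (fun s => -f (-s) - -c) =O[atBot] fun s : ℝ => Real.exp (-a * s ^ 2) := by
  have h2 := (h.comp_tendsto tendsto_neg_atBot_atTop).neg_left
  refine h2.congr (fun s => ?_) fun s => ?_
  · simp [neg_add_eq_sub]
  · simp

variable {B : Background} {q : ℝ → ℝ → ℂ} {t : ℝ}

theorem L1Decay.leftDecay (h : L1Decay B q t) :
    LeftDecay (fun s => q s t) (fun s => q (-s) (-t)) (B.qMinus t) (B.qPlus (-t)) where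
  left := integrableOn_Iic_of_limits (f := fun s => q s t) (h 0 1).1 (h 0 1).2
  right := integrableOn_Iic_of_limits (f := fun s => q (-s) (-t)) (h 1 0).1 (h 1 0).2

/-- These are the entries of `-Q(-x)`: the limit at `+∞` is now a limit at `-∞`. -/
theorem L1Decay.leftDecay_reflect (h : L1Decay B q t) :
    LeftDecay (fun s => -q (-s) t) (fun s => -q (- -s) (-t)) (-B.qPlus t) (-B.qMinus (-t)) where
  left := integrableOn_Iic_of_limits (f := fun s => -q (-s) t)
    (integrableOn_Iic_neg_comp_neg (f := fun s => q s t) (h 0 1).2)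
    (integrableOn_Ici_neg_comp_neg (f := fun s => q s t) (h 0 1).1)
  right := integrableOn_Iic_of_limits (f := fun s => -q (- -s) (-t))
    (integrableOn_Iic_neg_comp_neg (f := fun s => q (-s) (-t)) (h 1 0).2)
    (integrableOn_Ici_neg_comp_neg (f := fun s => q (-s) (-t)) (h 1 0).1)

end Entries

/-! ### The product of the boundary values -/

section Background

variable (B : Background) (t : ℝ)

theorem Background.phase_exp : exp (I * B.θp) * exp (I * B.θm) = 1 := by
  obtain ⟨n, hn⟩ := B.phase
  rw [← Complex.exp_add, ← mul_add, ← ofReal_add, hn]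
  push_cast
  rw [show I * (2 * (Real.pi : ℂ) * n) = n * (2 * Real.pi * I) by ring]
  exact exp_int_mul_two_pi_mul_I n

/-- The times `t` and `-t` cancel in the exponent and the phases add up to a multiple of `2π`. This
is what ties `λ² = k² - q₀²` to the constant system. -/
theorem Background.qMinus_mul_qPlus : B.qMinus t * B.qPlus (-t) = (B.q₀ : ℂ) ^ 2 := by
  have h := B.phase_exp
  rw [← Complex.exp_add] at h
  rw [qMinus, qPlus, mul_mul_mul_comm, ← Complex.exp_add,
    show I * (B.α * t + B.θm) + I * (B.α * (-t : ℝ) + B.θp) = I * B.θp + I * B.θm by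
      push_cast; ring, h]
  ring

theorem Background.qPlus_mul_qMinus : B.qPlus t * B.qMinus (-t) = (B.q₀ : ℂ) ^ 2 := by
  have := B.qMinus_mul_qPlus (-t)
  rwa [neg_neg, mul_comm] at this

end Background

/-! ### Uniformization of the Riemann surface -/

section Surface

/-- The uniformizing coordinate `ζ = lam + k` of the surface. -/
def Surface.zeta {q₀ : ℝ} (p : Surface q₀) : ℂ := p.lam + p.k

/-- The spectral parameter in terms of the uniformizing coordinate. -/
noncomputable def kOf (q₀ : ℝ) (z : ℂ) : ℂ := (z + q₀ ^ 2 / z) / 2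

/-- The value of `√(k² - q₀²)` in terms of the uniformizing coordinate. -/
noncomputable def lamOf (q₀ : ℝ) (z : ℂ) : ℂ := (z - q₀ ^ 2 / z) / 2

variable {q₀ : ℝ}

theorem Surface.lam_sq (p : Surface q₀) : p.lam ^ 2 = p.k ^ 2 - (q₀ : ℂ) ^ 2 := p.2

theorem Surface.continuous_zeta : Continuous (Surface.zeta (q₀ := q₀)) := by
  unfold Surface.zeta Surface.lam Surface.k
  fun_prop

theorem Surface.continuous_lam : Continuous (Surface.lam (q₀ := q₀)) := by
  unfold Surface.lam
  fun_prop

theorem Surface.zeta_mul (p : Surface q₀) : p.zeta * (p.k - p.lam) = (q₀ : ℂ) ^ 2 := by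
  rw [zeta]
  linear_combination -p.lam_sq

theorem Surface.zeta_ne_zero (h : 0 < q₀) (p : Surface q₀) : p.zeta ≠ 0 := by
  intro h0
  have := p.zeta_mul
  rw [h0, zero_mul] at this
  have h1 : (q₀ : ℂ) ≠ 0 := ofReal_ne_zero.2 h.ne'
  exact pow_ne_zero 2 h1 this.symm

theorem Surface.kOf_zeta (h : 0 < q₀) (p : Surface q₀) : kOf q₀ p.zeta = p.k := by
  rw [kOf, ← p.zeta_mul, mul_div_cancel_left₀ _ (p.zeta_ne_zero h), zeta]
  ring

theorem Surface.lamOf_zeta (h : 0 < q₀) (p : Surface q₀) : lamOf q₀ p.zeta = p.lam := by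
  rw [lamOf, ← p.zeta_mul, mul_div_cancel_left₀ _ (p.zeta_ne_zero h), zeta]
  ring

theorem differentiableOn_kOf : DifferentiableOn ℂ (kOf q₀) {0}ᶜ := by
  unfold kOf
  exact (differentiableOn_id.add ((differentiableOn_const _).div differentiableOn_id
    fun _ h => h)).div_const _

theorem differentiableOn_lamOf : DifferentiableOn ℂ (lamOf q₀) {0}ᶜ := by
  unfold lamOf
  exact (differentiableOn_id.sub ((differentiableOn_const _).div differentiableOn_id
    fun _ h => h)).div_const _

theorem Surface.lam_ne_zero {p : Surface q₀} (hp : p ∉ branchPoints q₀) : p.lam ≠ 0 := by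
  intro h0
  have h := p.lam_sq
  rw [h0] at h
  have h1 : (p.k - q₀) * (p.k - -q₀) = 0 := by linear_combination -h
  rcases mul_eq_zero.1 h1 with h2 | h2
  · exact hp (Or.inl (sub_eq_zero.1 h2))
  · exact hp (Or.inr (sub_eq_zero.1 h2))

/-- Over the cut `λ²` is real and nonnegative; a nonzero imaginary part would force `Re λ = 0` and
`λ² < 0`. -/
theorem lam_im_eq_zero_of_mem_cut (h : 0 < q₀) {p : Surface q₀} (hp : p ∈ cut q₀) :
    p.lam.im = 0 := by
  obtain ⟨h1, h2⟩ := hp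
  have h3 := p.lam_sq
  have hk : p.k = (p.k.re : ℂ) := Complex.ext rfl (by simp [h1])
  have h4 : q₀ ^ 2 ≤ p.k.re ^ 2 := by
    rw [← sq_abs p.k.re]
    exact pow_le_pow_left₀ h.le h2 2
  rw [hk] at h3
  have hre := congrArg Complex.re h3
  have him := congrArg Complex.im h3
  norm_cast at hre him
  simp only [sq, mul_re, mul_im] at hre him
  by_contra h0
  have h5 : p.lam.re = 0 := by
    have : p.lam.re * p.lam.im = 0 := by linarith
    exact (mul_eq_zero.1 this).resolve_right h0
  have h6 : 0 < p.lam.im * p.lam.im := mul_self_pos.2 h0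
  rw [h5] at hre
  nlinarith

/-- The coordinate `ζ` is the restriction of a linear function on `ℂ²`, so a function analytic in
`ζ` extends analytically to the ambient space. -/
theorem analyticAtPoint_of_zeta {f : Surface q₀ → ℂ} {h : ℂ → ℂ} {p : Surface q₀}
    (hh : AnalyticAt ℂ h p.zeta) (hf : ∀ᶠ p' in 𝓝 p, f p' = h p'.zeta) : AnalyticAtPoint f p := by
  refine ⟨fun x => h (x.2 + x.1), ?_, hf⟩
  exact AnalyticAt.comp (g := h) (f := fun x : ℂ × ℂ => x.2 + x.1) hh
    (analyticAt_snd.add analyticAt_fst)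

end Surface

/-! ### Reduction of the four eigenfunctions to the problem at `-∞` -/

section Solutions

theorem locallyIntegrable_const_add {F : Type*} [NormedAddCommGroup F] {f : ℝ → F}
    (h : LocallyIntegrable f volume) (c : F) : LocallyIntegrable (fun s => c + f s) volume :=
  (locallyIntegrable_const c).add h

variable {B : Background} {q : ℝ → ℝ → ℂ} {t : ℝ}

/-- The integral equation alone does not say that its integrand is integrable, the integral being
`0` by default otherwise; local integrability comes from that of `Q` and the continuity of `v`. -/
theorem isSolution_iff (h : L1Decay B q t) (k : ℂ) (v : ℝ → Fin 2 → ℂ) :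
    IsSolution q t k v ↔ IsPrimitive v fun s => ((I * k) • J + Q q t s) *ᵥ v s := by
  refine ⟨fun ⟨h1, h2⟩ => ⟨?_, h2⟩, fun h1 => ⟨h1.continuous, h1.eq⟩⟩
  -- With `μ = 0`, `leftMatrix` is the full limit `ikJ + Q₋` of the coefficient.
  set f : ℝ → (Fin 2 → ℂ) →L[ℂ] (Fin 2 → ℂ) := fun s =>
    leftMatrix (B.qMinus t) (B.qPlus (-t)) k 0 +
      leftPert (fun s => q s t) (fun s => q (-s) (-t)) (B.qMinus t) (B.qPlus (-t)) s with hf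
  have hfv : (fun s => ((I * k) • J + Q q t s) *ᵥ v s) = fun s => f s (v s) := by
    funext s
    rw [hf]
    simp only [add_apply, leftMatrix_apply]
    ext i
    fin_cases i <;>
      simp [leftPert, offDiag, toCLM_apply, J, Q, Matrix.vecHead, Matrix.vecTail] <;> ring
  have hfi : LocallyIntegrable f volume :=
    locallyIntegrable_const_add (fun x =>
      ⟨Set.Iic (x + 1), Iic_mem_nhds (by linarith), h.leftDecay.integrableOn _⟩) _
  rw [hfv]
  exact hfi.of_norm_le_mul_continuous h1
    (isBoundedBilinearMap_apply.continuous.comp_aestronglyMeasurable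
      (hfi.aestronglyMeasurable.prodMk h1.aestronglyMeasurable)) fun x => (f x).le_opNorm _

/-- The coefficient matrix has trace zero (Abel's identity). -/
theorem wronskian_eq {r l : ℝ → ℂ} {k : ℂ} {u v : ℝ → Fin 2 → ℂ}
    (hu : IsPrimitive u fun s => ((I * k) • J + !![0, r s; l s, 0]) *ᵥ u s)
    (hv : IsPrimitive v fun s => ((I * k) • J + !![0, r s; l s, 0]) *ᵥ v s) (x y : ℝ) :
    wronskian (u x) (v x) = wronskian (u y) (v y) := by
  have hu' := fun i => hu.clm (ContinuousLinearMap.proj (R := ℂ) (φ := fun _ : Fin 2 => ℂ) i)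
  have hv' := fun i => hv.clm (ContinuousLinearMap.proj (R := ℂ) (φ := fun _ : Fin 2 => ℂ) i)
  have h := ((hu' 0).smul (hv' 1)).sub ((hu' 1).smul (hv' 0))
  have h2 : IsPrimitive (fun x => wronskian (u x) (v x)) fun _ => 0 := by
    refine h.congr (fun x => rfl) fun x => ?_
    simp [J, Matrix.vecHead, Matrix.vecTail]
    ring
  have := h2.eq y x
  rw [intervalIntegral.integral_zero] at this
  exact sub_eq_zero.1 this

theorem wronskian_smul_smul (a b : ℂ) (u v : Fin 2 → ℂ) :
    wronskian (a • u) (b • v) = a * b * wronskian u v := by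
  simp only [wronskian, Pi.smul_apply, smul_eq_mul]
  ring

theorem isPhi_iff_isLeftSolution (h : L1Decay B q t) (p : Surface B.q₀) (φ : ℝ → Fin 2 → ℂ) :
    IsPhi B q t p φ ↔ IsLeftSolution (fun s => q s t) (fun s => q (-s) (-t)) p.k p.lam
      ![p.zeta, I * B.qPlus (-t)] φ := by
  rw [IsPhi, isSolution_iff h]
  rfl

/-- Choosing `μ = -λ` turns the closed lower sheet into the condition `0 ≤ Im μ`. -/
theorem isPhiBar_iff_isLeftSolution (h : L1Decay B q t) (p : Surface B.q₀) (φ : ℝ → Fin 2 → ℂ) :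
    IsPhiBar B q t p φ ↔ IsLeftSolution (fun s => q s t) (fun s => q (-s) (-t)) p.k (-p.lam)
      ![-(I * B.qMinus t), p.zeta] φ := by
  rw [IsPhiBar, isSolution_iff h, IsLeftSolution]
  simp only [mul_neg, neg_mul]
  rfl

/-- Reflection flips the sign of the whole coefficient; putting that sign on `k` and on the
off-diagonal entries keeps the shape of the system. -/
theorem isPrimitive_comp_neg_iff {r l : ℝ → ℂ} {k : ℂ} {u : ℝ → Fin 2 → ℂ} :
    IsPrimitive (fun x => u (-x)) (fun s => ((I * -k) • J + !![0, -r (-s); -l (-s), 0]) *ᵥ u (-s))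
      ↔ IsPrimitive u fun s => ((I * k) • J + !![0, r s; l s, 0]) *ᵥ u s := by
  have hneg : ∀ s, ((I * -k) • J + !![0, -r (-s); -l (-s), 0]) *ᵥ u (-s) =
      -(((I * k) • J + !![0, r (-s); l (-s), 0]) *ᵥ u (-s)) := fun s => by
    rw [← Matrix.neg_mulVec]
    congr 1
    ext i j
    fin_cases i <;> fin_cases j <;> simp [J]
  constructor
  · intro h
    refine h.comp_neg.congr (fun x => by rw [neg_neg]) fun x => ?_
    rw [hneg, neg_neg, neg_neg]
  · intro h
    exact h.comp_neg.congr (fun x => rfl) hneg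

theorem tendsto_comp_neg_atBot_iff {F : Type*} {f : ℝ → F} {l : Filter F} :
    Tendsto (fun x => f (-x)) atBot l ↔ Tendsto f atTop l := by
  refine ⟨fun h => ?_, fun h => h.comp tendsto_neg_atBot_atTop⟩
  simpa [Function.comp_def] using h.comp tendsto_neg_atTop_atBot

theorem isPsi_iff_isLeftSolution (h : L1Decay B q t) (p : Surface B.q₀) (ψ : ℝ → Fin 2 → ℂ) :
    IsPsi B q t p ψ ↔ IsLeftSolution (fun s => -q (-s) t) (fun s => -q (- -s) (-t)) (-p.k) p.lam
      ![-(I * B.qPlus t), p.zeta] fun x => ψ (-x) := by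
  rw [IsPsi, isSolution_iff h, IsLeftSolution,
    isPrimitive_comp_neg_iff (r := fun s => q s t) (l := fun s => q (-s) (-t)),
    ← tendsto_comp_neg_atBot_iff]
  simp only [ofReal_neg, mul_neg, neg_neg]
  rfl

theorem isPsiBar_iff_isLeftSolution (h : L1Decay B q t) (p : Surface B.q₀) (ψ : ℝ → Fin 2 → ℂ) :
    IsPsiBar B q t p ψ ↔ IsLeftSolution (fun s => -q (-s) t) (fun s => -q (- -s) (-t)) (-p.k)
      (-p.lam) ![p.zeta, I * B.qMinus (-t)] fun x => ψ (-x) := by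
  rw [IsPsiBar, isSolution_iff h, IsLeftSolution,
    isPrimitive_comp_neg_iff (r := fun s => q s t) (l := fun s => q (-s) (-t)),
    ← tendsto_comp_neg_atBot_iff]
  simp only [ofReal_neg, mul_neg, neg_mul]
  rfl

end Solutions

/-! ### Eigenfunctions, their Wronskians and the scattering relations -/

section Eigenfunctions

variable {B : Background} {q : ℝ → ℝ → ℂ} {t : ℝ}

variable (B q t) in
/-- The value of `φ` at `x = 0`, in terms of the uniformizing coordinate. -/
noncomputable def jostPhi (z : ℂ) : Fin 2 → ℂ :=
  leftJost (fun s => q s t) (fun s => q (-s) (-t)) (B.qMinus t) (B.qPlus (-t)) (kOf B.q₀ z)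
    (lamOf B.q₀ z) ![z, I * B.qPlus (-t)] 0

variable (B q t) in
/-- The value of `φ̄` at `x = 0`, in terms of the uniformizing coordinate. -/
noncomputable def jostPhiBar (z : ℂ) : Fin 2 → ℂ :=
  leftJost (fun s => q s t) (fun s => q (-s) (-t)) (B.qMinus t) (B.qPlus (-t)) (kOf B.q₀ z)
    (-lamOf B.q₀ z) ![-(I * B.qMinus t), z] 0

variable (B q t) in
/-- The value of `ψ` at `x = 0`, in terms of the uniformizing coordinate. -/
noncomputable def jostPsi (z : ℂ) : Fin 2 → ℂ :=
  leftJost (fun s => -q (-s) t) (fun s => -q (- -s) (-t)) (-B.qPlus t) (-B.qMinus (-t))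
    (-kOf B.q₀ z) (lamOf B.q₀ z) ![-(I * B.qPlus t), z] 0

variable (B q t) in
/-- The value of `ψ̄` at `x = 0`, in terms of the uniformizing coordinate. -/
noncomputable def jostPsiBar (z : ℂ) : Fin 2 → ℂ :=
  leftJost (fun s => -q (-s) t) (fun s => -q (- -s) (-t)) (-B.qPlus t) (-B.qMinus (-t))
    (-kOf B.q₀ z) (-lamOf B.q₀ z) ![z, I * B.qMinus (-t)] 0

theorem existsUnique_and_epsilon_eq {α : Type*} [Nonempty α] {P : α → Prop} {x : α}
    (h : ∀ y, P y ↔ y = x) : (∃! y, P y) ∧ Classical.epsilon P = x :=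
  ⟨⟨x, (h x).2 rfl, fun y hy => (h y).1 hy⟩,
    (h _).1 (Classical.epsilon_spec (p := P) ⟨x, (h x).2 rfl⟩)⟩

theorem comp_neg_eq_iff {F : Type*} {f g : ℝ → F} :
    ((fun x => f (-x)) = g) ↔ f = fun x => g (-x) := by
  constructor
  · rintro rfl
    simp
  · rintro rfl
    simp

variable {p : Surface B.q₀}

/-- The point to check is that the prescribed asymptotic vector lies in the kernel of the constant
matrix; this is `ζ (k - λ) = q₀² = q₋(t) q₊(-t)`. -/
theorem existsUnique_isPhi (h : L1Decay B q t) (hp : p.lam ≠ 0) (him : 0 ≤ p.lam.im) :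
    (∃! φ, IsPhi B q t p φ) ∧ phi B q t p 0 = jostPhi B q t p.zeta := by
  have hv : leftMatrix (B.qMinus t) (B.qPlus (-t)) p.k p.lam ![p.zeta, I * B.qPlus (-t)] = 0 := by
    have h1 := p.zeta_mul
    have h2 := B.qMinus_mul_qPlus t
    rw [leftMatrix_apply]
    ext i
    fin_cases i
    · simp
      linear_combination -I * h1 + I * h2
    · simp [Surface.zeta]
      linear_combination (p.lam + p.k) * B.qPlus (-t) * I_sq
  have hiff := fun φ => (isPhi_iff_isLeftSolution h p φ).trans (h.leftDecay.isLeftSolution_iff hp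
    him (by rw [B.qMinus_mul_qPlus, p.lam_sq]) hv φ)
  obtain ⟨h1, h2⟩ := existsUnique_and_epsilon_eq hiff
  refine ⟨h1, ?_⟩
  rw [phi, h2, jostPhi, p.kOf_zeta B.pos, p.lamOf_zeta B.pos]
  simp

theorem existsUnique_isPhiBar (h : L1Decay B q t) (hp : p.lam ≠ 0) (him : p.lam.im ≤ 0) :
    (∃! φ, IsPhiBar B q t p φ) ∧ phiBar B q t p 0 = jostPhiBar B q t p.zeta := by
  have hv : leftMatrix (B.qMinus t) (B.qPlus (-t)) p.k (-p.lam)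
      ![-(I * B.qMinus t), p.zeta] = 0 := by
    have h1 := p.zeta_mul
    have h2 := B.qMinus_mul_qPlus t
    rw [leftMatrix_apply]
    ext i
    fin_cases i
    · simp [Surface.zeta]
      linear_combination (p.lam + p.k) * B.qMinus t * I_sq
    · simp
      linear_combination I * h1 - I * h2
  have hiff := fun φ => (isPhiBar_iff_isLeftSolution h p φ).trans
    (h.leftDecay.isLeftSolution_iff (neg_ne_zero.2 hp)
    (by simpa using him) (by rw [B.qMinus_mul_qPlus, neg_sq, p.lam_sq]) hv φ)
  obtain ⟨h1, h2⟩ := existsUnique_and_epsilon_eq hiff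
  refine ⟨h1, ?_⟩
  rw [phiBar, h2, jostPhiBar, p.kOf_zeta B.pos, p.lamOf_zeta B.pos]
  simp

theorem existsUnique_isPsi (h : L1Decay B q t) (hp : p.lam ≠ 0) (him : 0 ≤ p.lam.im) :
    (∃! ψ, IsPsi B q t p ψ) ∧ psi B q t p 0 = jostPsi B q t p.zeta := by
  have hv : leftMatrix (-B.qPlus t) (-B.qMinus (-t)) (-p.k) p.lam
      ![-(I * B.qPlus t), p.zeta] = 0 := by
    have h1 := p.zeta_mul
    have h2 := B.qPlus_mul_qMinus t
    rw [leftMatrix_apply]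
    ext i
    fin_cases i
    · simp [Surface.zeta]
      linear_combination -(p.lam + p.k) * B.qPlus t * I_sq
    · simp
      linear_combination -I * h1 + I * h2
  have hiff := fun ψ => ((isPsi_iff_isLeftSolution h p ψ).trans
    (h.leftDecay_reflect.isLeftSolution_iff hp him
    (by rw [neg_mul_neg, B.qPlus_mul_qMinus, neg_sq, p.lam_sq]) hv _)).trans comp_neg_eq_iff
  obtain ⟨h1, h2⟩ := existsUnique_and_epsilon_eq hiff
  refine ⟨h1, ?_⟩
  rw [psi, h2, jostPsi, p.kOf_zeta B.pos, p.lamOf_zeta B.pos]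
  simp

theorem existsUnique_isPsiBar (h : L1Decay B q t) (hp : p.lam ≠ 0) (him : p.lam.im ≤ 0) :
    (∃! ψ, IsPsiBar B q t p ψ) ∧ psiBar B q t p 0 = jostPsiBar B q t p.zeta := by
  have hv : leftMatrix (-B.qPlus t) (-B.qMinus (-t)) (-p.k) (-p.lam)
      ![p.zeta, I * B.qMinus (-t)] = 0 := by
    have h1 := p.zeta_mul
    have h2 := B.qPlus_mul_qMinus t
    rw [leftMatrix_apply]
    ext i
    fin_cases i
    · simp
      linear_combination I * h1 - I * h2
    · simp [Surface.zeta]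
      linear_combination -(p.lam + p.k) * B.qMinus (-t) * I_sq
  have hiff := fun ψ => ((isPsiBar_iff_isLeftSolution h p ψ).trans
    (h.leftDecay_reflect.isLeftSolution_iff (neg_ne_zero.2 hp) (by simpa using him)
    (by rw [neg_mul_neg, B.qPlus_mul_qMinus, neg_sq, neg_sq, p.lam_sq]) hv _)).trans
      comp_neg_eq_iff
  obtain ⟨h1, h2⟩ := existsUnique_and_epsilon_eq hiff
  refine ⟨h1, ?_⟩
  rw [psiBar, h2, jostPsiBar, p.kOf_zeta B.pos, p.lamOf_zeta B.pos]
  simp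

theorem isPhi_phi (h : L1Decay B q t) (hp : p.lam ≠ 0) (him : 0 ≤ p.lam.im) :
    IsPhi B q t p (phi B q t p) :=
  Classical.epsilon_spec (existsUnique_isPhi h hp him).1.exists

theorem isPhiBar_phiBar (h : L1Decay B q t) (hp : p.lam ≠ 0) (him : p.lam.im ≤ 0) :
    IsPhiBar B q t p (phiBar B q t p) :=
  Classical.epsilon_spec (existsUnique_isPhiBar h hp him).1.exists

theorem isPsi_psi (h : L1Decay B q t) (hp : p.lam ≠ 0) (him : 0 ≤ p.lam.im) :
    IsPsi B q t p (psi B q t p) :=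
  Classical.epsilon_spec (existsUnique_isPsi h hp him).1.exists

theorem isPsiBar_psiBar (h : L1Decay B q t) (hp : p.lam ≠ 0) (him : p.lam.im ≤ 0) :
    IsPsiBar B q t p (psiBar B q t p) :=
  Classical.epsilon_spec (existsUnique_isPsiBar h hp him).1.exists

/-- The Wronskian of two solutions is constant. -/
theorem IsSolution.wronskian_eq (h : L1Decay B q t) {k : ℂ} {u v : ℝ → Fin 2 → ℂ}
    (hu : IsSolution q t k u) (hv : IsSolution q t k v) (x y : ℝ) :
    wronskian (u x) (v x) = wronskian (u y) (v y) :=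
  RST.wronskian_eq (r := fun s => q s t) (l := fun s => q (-s) (-t)) ((isSolution_iff h k u).1 hu)
    ((isSolution_iff h k v).1 hv) x y

theorem continuous_wronskian :
    Continuous fun w : (Fin 2 → ℂ) × (Fin 2 → ℂ) => wronskian w.1 w.2 := by
  unfold wronskian
  fun_prop

/-- The exponential factors cancel, so the constant Wronskian equals that of the limit vectors at
`+∞`, namely `q₀² - ζ² = -2λζ`. -/
theorem wronskian_psi_psiBar (h : L1Decay B q t) {ψ ψ' : ℝ → Fin 2 → ℂ}
    (hψ : IsPsi B q t p ψ) (hψ' : IsPsiBar B q t p ψ') (x : ℝ) :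
    wronskian (ψ x) (ψ' x) = -(2 * p.lam * (p.lam + p.k)) := by
  have h1 : Tendsto (fun y : ℝ => wronskian (exp (-(I * p.lam * y)) • ψ y)
      (exp (I * p.lam * y) • ψ' y)) atTop (𝓝 (wronskian ![-(I * B.qPlus t), p.lam + p.k]
        ![p.lam + p.k, I * B.qMinus (-t)])) :=
    (continuous_wronskian.tendsto _).comp (hψ.2.prodMk_nhds hψ'.2)
  have h2 : (fun y : ℝ => wronskian (exp (-(I * p.lam * y)) • ψ y)
      (exp (I * p.lam * y) • ψ' y)) = fun _ => wronskian (ψ x) (ψ' x) := by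
    funext y
    rw [wronskian_smul_smul, ← Complex.exp_add, neg_add_cancel, exp_zero, one_mul,
      hψ.1.wronskian_eq h hψ'.1 y x]
  rw [h2] at h1
  rw [tendsto_nhds_unique tendsto_const_nhds h1]
  have h3 := B.qPlus_mul_qMinus t
  have h4 := p.lam_sq
  simp only [wronskian, Matrix.cons_val_zero, Matrix.cons_val_one, Matrix.cons_val_fin_one]
  linear_combination -(B.qPlus t * B.qMinus (-t)) * I_sq + h3 + h4

/-- Cramer's rule; the Wronskian is the determinant. -/
theorem eq_smul_add_smul_of_wronskian {u v w : Fin 2 → ℂ} {d : ℂ} (hd : d ≠ 0)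
    (h : wronskian v w = -d) :
    u = (-wronskian u w / d) • v + (wronskian u v / d) • w := by
  simp only [wronskian] at h ⊢
  ext i
  simp only [Pi.add_apply, Pi.smul_apply, smul_eq_mul]
  field_simp
  fin_cases i
  · simp only [Fin.zero_eta]
    linear_combination u 0 * h
  · simp only [Fin.mk_one]
    linear_combination u 1 * h

theorem scatteringDataWellDefined (h : L1Decay B q t) : ScatteringDataWellDefined B q t := by
  refine ⟨fun p hp => ?_, fun p hp => ?_, fun p hp x => ?_⟩
  · have h0 := Surface.lam_ne_zero hp.2
    refine ⟨(existsUnique_isPhi h h0 hp.1).1, (existsUnique_isPsi h h0 hp.1).1, fun x => ?_⟩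
    rw [a, (isPhi_phi h h0 hp.1).1.wronskian_eq h (isPsi_psi h h0 hp.1).1 0 x]
  · have h0 := Surface.lam_ne_zero hp.2
    refine ⟨(existsUnique_isPhiBar h h0 hp.1).1, (existsUnique_isPsiBar h h0 hp.1).1,
      fun x => ?_⟩
    rw [aBar, (isPhiBar_phiBar h h0 hp.1).1.wronskian_eq h (isPsiBar_psiBar h h0 hp.1).1 0 x]
  · have h0 := Surface.lam_ne_zero hp.2
    have him := lam_im_eq_zero_of_mem_cut B.pos hp.1
    have hφ := isPhi_phi h h0 him.ge
    have hφ' := isPhiBar_phiBar h h0 him.le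
    have hψ := isPsi_psi h h0 him.ge
    have hψ' := isPsiBar_psiBar h h0 him.le
    have hd : 2 * p.lam * (p.lam + p.k) ≠ 0 :=
      mul_ne_zero (mul_ne_zero two_ne_zero h0) (p.zeta_ne_zero B.pos)
    have hW := wronskian_psi_psiBar h hψ hψ' x
    rw [a, b, aBar, bBar, hφ.1.wronskian_eq h hψ.1 0 x, hφ.1.wronskian_eq h hψ'.1 0 x,
      hφ'.1.wronskian_eq h hψ'.1 0 x, hφ'.1.wronskian_eq h hψ.1 0 x]
    exact ⟨eq_smul_add_smul_of_wronskian hd hW, eq_smul_add_smul_of_wronskian hd hW⟩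

end Eigenfunctions

/-! ### Regularity of the eigenfunctions at `x = 0` in the uniformizing coordinate -/

section Regularity

/-- The regularity in the uniformizing coordinate of an eigenfunction that exists for
`0 ≤ im μ`, under the three decay conditions. -/
structure RegularFamily (B : Background) (q : ℝ → ℝ → ℂ) (t : ℝ) (μ : ℂ → ℂ)
    (f : ℂ → Fin 2 → ℂ) : Prop where
  cont : ContinuousOn f {z | z ≠ 0 ∧ 0 ≤ (μ z).im ∧ μ z ≠ 0}
  diff : DifferentiableOn ℂ f {z | z ≠ 0 ∧ 0 < (μ z).im}
  cont_weight : L12Decay B q t → ContinuousOn f {z | z ≠ 0 ∧ 0 ≤ (μ z).im}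
  diff_gaussian : GaussianDecay B q t → DifferentiableOn ℂ f {0}ᶜ

variable {B : Background} {q : ℝ → ℝ → ℂ} {t : ℝ}

theorem isOpen_im_pos {μ : ℂ → ℂ} (hμ : DifferentiableOn ℂ μ {0}ᶜ) :
    IsOpen {z : ℂ | z ≠ 0 ∧ 0 < (μ z).im} :=
  hμ.continuousOn.isOpen_inter_preimage isOpen_compl_singleton
    (isOpen_lt continuous_const continuous_im)

theorem LeftDecay.regularFamily {r l : ℝ → ℂ} {r₀ l₀ : ℂ} {κ μ : ℂ → ℂ} {v : ℂ → Fin 2 → ℂ}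
    (h : LeftDecay r l r₀ l₀)
    (hw : L12Decay B q t → IntegrableOn (fun s => ‖r s - r₀‖ * (1 + |s|) ^ 2) (Set.Iic 0) ∧
      IntegrableOn (fun s => ‖l s - l₀‖ * (1 + |s|) ^ 2) (Set.Iic 0))
    (hg : GaussianDecay B q t → ∃ c : ℝ, 0 < c ∧
      ((fun s => r s - r₀) =O[atBot] fun s : ℝ => Real.exp (-c * s ^ 2)) ∧
      (fun s => l s - l₀) =O[atBot] fun s : ℝ => Real.exp (-c * s ^ 2))
    (hκ : DifferentiableOn ℂ κ {0}ᶜ) (hμ : DifferentiableOn ℂ μ {0}ᶜ)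
    (hv : Differentiable ℂ v) :
    RegularFamily B q t μ fun z => leftJost r l r₀ l₀ (κ z) (μ z) (v z) 0 where
  cont := h.continuousOn_leftJost hκ hμ hv.differentiableOn (fun z hz => hz.1)
    (fun z hz => hz.2.2) (fun z hz => hz.2.1) 0
  diff := by
    have hsub : {z : ℂ | z ≠ 0 ∧ 0 < (μ z).im} ⊆ {0}ᶜ := fun z hz => hz.1
    exact h.differentiableOn_leftJost (isOpen_im_pos hμ) (hκ.mono hsub) (hμ.mono hsub)
      hv.differentiableOn (fun z hz h0 => by simp [h0] at hz) (fun z hz => hz.2.le) 0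
  cont_weight h12 := h.continuousOn_leftJost_of_weight (hw h12).1 (hw h12).2 hκ hμ
    hv.differentiableOn (fun z hz => hz.1) (fun z hz => hz.2) 0
  diff_gaussian hG := by
    obtain ⟨c, hc, hr, hl⟩ := hg hG
    exact h.differentiableOn_leftJost_of_gaussian hc hr hl isOpen_compl_singleton hκ hμ
      hv.differentiableOn 0

theorem differentiable_vec {f g : ℂ → ℂ} (hf : Differentiable ℂ f) (hg : Differentiable ℂ g) :
    Differentiable ℂ fun z => ![f z, g z] := by
  refine differentiable_pi.2 fun i => ?_
  fin_cases i
  · exact hf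
  · exact hg

theorem GaussianDecay.left (h : GaussianDecay B q t) : ∃ c : ℝ, 0 < c ∧
    ((fun s => q s t - B.qMinus t) =O[atBot] fun s : ℝ => Real.exp (-c * s ^ 2)) ∧
    (fun s => q (-s) (-t) - B.qPlus (-t)) =O[atBot] fun s : ℝ => Real.exp (-c * s ^ 2) := by
  obtain ⟨c, hc, h⟩ := h
  exact ⟨c, hc, (h 0 1).1, (h 1 0).1⟩

theorem GaussianDecay.right (h : GaussianDecay B q t) : ∃ c : ℝ, 0 < c ∧
    ((fun s => -q (-s) t - -B.qPlus t) =O[atBot] fun s : ℝ => Real.exp (-c * s ^ 2)) ∧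
    (fun s => -q (- -s) (-t) - -B.qMinus (-t)) =O[atBot]
      fun s : ℝ => Real.exp (-c * s ^ 2) := by
  obtain ⟨c, hc, h⟩ := h
  exact ⟨c, hc, isBigO_atBot_neg_comp_neg (f := fun s => q s t) (h 0 1).2,
    isBigO_atBot_neg_comp_neg (f := fun s => q (-s) (-t)) (h 1 0).2⟩

theorem L12Decay.left (h : L12Decay B q t) :
    IntegrableOn (fun s => ‖q s t - B.qMinus t‖ * (1 + |s|) ^ 2) (Set.Iic 0) ∧
    IntegrableOn (fun s => ‖q (-s) (-t) - B.qPlus (-t)‖ * (1 + |s|) ^ 2) (Set.Iic 0) :=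
  ⟨(h 0 1).1, (h 1 0).1⟩

theorem L12Decay.right (h : L12Decay B q t) :
    IntegrableOn (fun s => ‖-q (-s) t - -B.qPlus t‖ * (1 + |s|) ^ 2) (Set.Iic 0) ∧
    IntegrableOn (fun s => ‖-q (- -s) (-t) - -B.qMinus (-t)‖ * (1 + |s|) ^ 2) (Set.Iic 0) :=
  ⟨integrableOn_weight_neg_comp_neg (f := fun s => q s t) (h 0 1).2,
    integrableOn_weight_neg_comp_neg (f := fun s => q (-s) (-t)) (h 1 0).2⟩

theorem regularFamily_jostPhi (h : L1Decay B q t) :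
    RegularFamily B q t (lamOf B.q₀) (jostPhi B q t) :=
  h.leftDecay.regularFamily L12Decay.left GaussianDecay.left differentiableOn_kOf
    differentiableOn_lamOf (differentiable_vec differentiable_id (differentiable_const _))

theorem regularFamily_jostPhiBar (h : L1Decay B q t) :
    RegularFamily B q t (fun z => -lamOf B.q₀ z) (jostPhiBar B q t) :=
  h.leftDecay.regularFamily L12Decay.left GaussianDecay.left differentiableOn_kOf
    differentiableOn_lamOf.fun_neg (differentiable_vec (differentiable_const _) differentiable_id)

theorem regularFamily_jostPsi (h : L1Decay B q t) :
    RegularFamily B q t (lamOf B.q₀) (jostPsi B q t) :=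
  h.leftDecay_reflect.regularFamily L12Decay.right GaussianDecay.right differentiableOn_kOf.fun_neg
    differentiableOn_lamOf (differentiable_vec (differentiable_const _) differentiable_id)

theorem regularFamily_jostPsiBar (h : L1Decay B q t) :
    RegularFamily B q t (fun z => -lamOf B.q₀ z) (jostPsiBar B q t) :=
  h.leftDecay_reflect.regularFamily L12Decay.right GaussianDecay.right differentiableOn_kOf.fun_neg
    differentiableOn_lamOf.fun_neg
    (differentiable_vec differentiable_id (differentiable_const _))

theorem continuousOn_wronskian {f g : ℂ → Fin 2 → ℂ} {S : Set ℂ} (hf : ContinuousOn f S)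
    (hg : ContinuousOn g S) : ContinuousOn (fun z => wronskian (f z) (g z)) S :=
  continuous_wronskian.comp_continuousOn (hf.prodMk hg)

theorem differentiableOn_wronskian {f g : ℂ → Fin 2 → ℂ} {S : Set ℂ}
    (hf : DifferentiableOn ℂ f S) (hg : DifferentiableOn ℂ g S) :
    DifferentiableOn ℂ (fun z => wronskian (f z) (g z)) S := by
  have hf' := differentiableOn_pi.1 hf
  have hg' := differentiableOn_pi.1 hg
  exact ((hf' 0).mul (hg' 1)).sub ((hf' 1).mul (hg' 0))

end Regularity

/-! ### Transfer from the uniformizing coordinate to the surface -/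

section Coefficients

variable {q₀ : ℝ} {c : Surface q₀ → ℂ} {W : ℂ → ℂ} {D : Set (Surface q₀)} {S : Set ℂ}

theorem continuousOn_coefficient (h0 : 0 < q₀) (hW : ContinuousOn W S)
    (hS : ∀ p ∈ D, p.zeta ∈ S) (hlam : ∀ p ∈ D, p.lam ≠ 0)
    (hc : ∀ p ∈ D, c p = W p.zeta / (2 * p.lam * p.zeta)) : ContinuousOn c D := by
  refine ContinuousOn.congr (f := fun p : Surface q₀ => W p.zeta / (2 * p.lam * p.zeta)) ?_ hc
  exact (hW.comp Surface.continuous_zeta.continuousOn hS).div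
    ((continuous_const.mul Surface.continuous_lam).mul Surface.continuous_zeta).continuousOn
    fun p hp => mul_ne_zero (mul_ne_zero two_ne_zero (hlam p hp)) (p.zeta_ne_zero h0)

theorem analyticAtPoint_coefficient (h0 : 0 < q₀) {p : Surface q₀} (hS : IsOpen S)
    (hW : DifferentiableOn ℂ W S) (hp : p.zeta ∈ S) (hlam : p.lam ≠ 0)
    (hc : ∀ᶠ p' in 𝓝 p, c p' = W p'.zeta / (2 * p'.lam * p'.zeta)) : AnalyticAtPoint c p := by
  have hz := p.zeta_ne_zero h0
  have h1 : AnalyticAt ℂ (lamOf q₀) p.zeta :=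
    differentiableOn_lamOf.analyticAt (isOpen_compl_singleton.mem_nhds hz)
  have h2 : AnalyticAt ℂ (fun z => W z / (2 * lamOf q₀ z * z)) p.zeta :=
    (hW.analyticAt (hS.mem_nhds hp)).div ((analyticAt_const.mul h1).mul analyticAt_id)
      (by rw [p.lamOf_zeta h0]; exact mul_ne_zero (mul_ne_zero two_ne_zero hlam) hz)
  refine analyticAtPoint_of_zeta h2 (hc.mono fun p' h => ?_)
  rw [h, p'.lamOf_zeta h0]

/-- Once `λ` is cancelled the denominator is `2ζ`, which has no zero, so the branch points are no
longer special. -/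
theorem continuousOn_extension (h0 : 0 < q₀) (hW : ContinuousOn W S)
    (hS : ∀ p ∈ D, p.zeta ∈ S) :
    ContinuousOn (fun p : Surface q₀ => W p.zeta / (2 * p.zeta)) D :=
  (hW.comp Surface.continuous_zeta.continuousOn hS).div
    (continuous_const.mul Surface.continuous_zeta).continuousOn
    fun p _ => mul_ne_zero two_ne_zero (p.zeta_ne_zero h0)

theorem analyticAtPoint_extension (h0 : 0 < q₀) {p : Surface q₀} (hS : IsOpen S)
    (hW : DifferentiableOn ℂ W S) (hp : p.zeta ∈ S) :
    AnalyticAtPoint (fun p : Surface q₀ => W p.zeta / (2 * p.zeta)) p := by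
  have hz := p.zeta_ne_zero h0
  exact analyticAtPoint_of_zeta (h := fun z => W z / (2 * z))
    ((hW.analyticAt (hS.mem_nhds hp)).div (analyticAt_const.mul analyticAt_id)
      (mul_ne_zero two_ne_zero hz)) (Eventually.of_forall fun _ => rfl)

theorem extension_eq {p : Surface q₀} (h0 : 0 < q₀) (hlam : p.lam ≠ 0)
    (hc : c p = W p.zeta / (2 * p.lam * p.zeta)) : W p.zeta / (2 * p.zeta) = c p * p.lam := by
  have hz := p.zeta_ne_zero h0
  rw [hc]
  field_simp

end Coefficients

/-! ### Scattering data as Wronskians of Neumann series -/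

section ScatteringData

variable {B : Background} {q : ℝ → ℝ → ℂ} {t : ℝ} {p : Surface B.q₀}

theorem a_eq (h : L1Decay B q t) (hp : p.lam ≠ 0) (him : 0 ≤ p.lam.im) :
    a B q t p = wronskian (jostPhi B q t p.zeta) (jostPsi B q t p.zeta) /
      (2 * p.lam * p.zeta) := by
  rw [a, (existsUnique_isPhi h hp him).2, (existsUnique_isPsi h hp him).2, Surface.zeta]

theorem aBar_eq (h : L1Decay B q t) (hp : p.lam ≠ 0) (him : p.lam.im ≤ 0) :
    aBar B q t p = -wronskian (jostPhiBar B q t p.zeta) (jostPsiBar B q t p.zeta) /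
      (2 * p.lam * p.zeta) := by
  rw [aBar, (existsUnique_isPhiBar h hp him).2, (existsUnique_isPsiBar h hp him).2, Surface.zeta]

theorem b_eq (h : L1Decay B q t) (hp : p.lam ≠ 0) (him : p.lam.im = 0) :
    b B q t p = -wronskian (jostPhi B q t p.zeta) (jostPsiBar B q t p.zeta) /
      (2 * p.lam * p.zeta) := by
  rw [b, (existsUnique_isPhi h hp him.ge).2, (existsUnique_isPsiBar h hp him.le).2, Surface.zeta]

theorem bBar_eq (h : L1Decay B q t) (hp : p.lam ≠ 0) (him : p.lam.im = 0) :
    bBar B q t p = wronskian (jostPhiBar B q t p.zeta) (jostPsi B q t p.zeta) /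
      (2 * p.lam * p.zeta) := by
  rw [bBar, (existsUnique_isPhiBar h hp him.le).2, (existsUnique_isPsi h hp him.ge).2,
    Surface.zeta]

end ScatteringData

end RST

/-! ### Assembly of the theorem -/

theorem theorem2 (B : RST.Background) (q : ℝ → ℝ → ℂ) (t : ℝ) (hL1 : RST.L1Decay B q t) :
    RST.ScatteringDataWellDefined B q t ∧
    -- decay in `L¹`
    (ContinuousOn (RST.a B q t) (RST.closedUpperSheet B.q₀ \ RST.branchPoints B.q₀) ∧
      (∀ p ∈ RST.upperSheet B.q₀, RST.AnalyticAtPoint (RST.a B q t) p) ∧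
      ContinuousOn (RST.aBar B q t) (RST.closedLowerSheet B.q₀ \ RST.branchPoints B.q₀) ∧
      (∀ p ∈ RST.lowerSheet B.q₀, RST.AnalyticAtPoint (RST.aBar B q t) p) ∧
      ContinuousOn (RST.b B q t) (RST.cut B.q₀ \ RST.branchPoints B.q₀) ∧
      ContinuousOn (RST.bBar B q t) (RST.cut B.q₀ \ RST.branchPoints B.q₀)) ∧
    -- decay in `L^{1,2}`: continuous extension to the branch points
    (RST.L12Decay B q t →
      (∃ F : RST.Surface B.q₀ → ℂ,
        (∀ p ∈ RST.closedUpperSheet B.q₀ \ RST.branchPoints B.q₀, F p = RST.a B q t p * p.lam) ∧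
        ContinuousOn F (RST.closedUpperSheet B.q₀) ∧
        ∀ p ∈ RST.upperSheet B.q₀, RST.AnalyticAtPoint F p) ∧
      (∃ F : RST.Surface B.q₀ → ℂ,
        (∀ p ∈ RST.closedLowerSheet B.q₀ \ RST.branchPoints B.q₀,
          F p = RST.aBar B q t p * p.lam) ∧
        ContinuousOn F (RST.closedLowerSheet B.q₀) ∧
        ∀ p ∈ RST.lowerSheet B.q₀, RST.AnalyticAtPoint F p) ∧
      (∃ F : RST.Surface B.q₀ → ℂ,
        (∀ p ∈ RST.cut B.q₀ \ RST.branchPoints B.q₀, F p = RST.b B q t p * p.lam) ∧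
        ContinuousOn F (RST.cut B.q₀)) ∧
      (∃ F : RST.Surface B.q₀ → ℂ,
        (∀ p ∈ RST.cut B.q₀ \ RST.branchPoints B.q₀, F p = RST.bBar B q t p * p.lam) ∧
        ContinuousOn F (RST.cut B.q₀))) ∧
    -- Gaussian decay: analytic extension to the whole Riemann surface
    (RST.GaussianDecay B q t →
      (∃ F : RST.Surface B.q₀ → ℂ,
        (∀ p ∈ RST.closedUpperSheet B.q₀ \ RST.branchPoints B.q₀, F p = RST.a B q t p * p.lam) ∧
        ∀ p, RST.AnalyticAtPoint F p) ∧
      (∃ F : RST.Surface B.q₀ → ℂ,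
        (∀ p ∈ RST.closedLowerSheet B.q₀ \ RST.branchPoints B.q₀,
          F p = RST.aBar B q t p * p.lam) ∧
        ∀ p, RST.AnalyticAtPoint F p) ∧
      (∃ F : RST.Surface B.q₀ → ℂ,
        (∀ p ∈ RST.cut B.q₀ \ RST.branchPoints B.q₀, F p = RST.b B q t p * p.lam) ∧
        ∀ p, RST.AnalyticAtPoint F p) ∧
      (∃ F : RST.Surface B.q₀ → ℂ,
        (∀ p ∈ RST.cut B.q₀ \ RST.branchPoints B.q₀, F p = RST.bBar B q t p * p.lam) ∧
        ∀ p, RST.AnalyticAtPoint F p)) := by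
  have hpos := B.pos
  have hφ := RST.regularFamily_jostPhi hL1
  have hφ' := RST.regularFamily_jostPhiBar hL1
  have hψ := RST.regularFamily_jostPsi hL1
  have hψ' := RST.regularFamily_jostPsiBar hL1
  have hz : ∀ p : RST.Surface B.q₀, p.zeta ≠ 0 := fun p => p.zeta_ne_zero hpos
  have hl : ∀ p : RST.Surface B.q₀, RST.lamOf B.q₀ p.zeta = p.lam := fun p => p.lamOf_zeta hpos
  have hcut := fun (p : RST.Surface B.q₀) (hp : p ∈ RST.cut B.q₀) =>
    RST.lam_im_eq_zero_of_mem_cut hpos hp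
  -- the sets in the uniformizing coordinate
  have hU : ∀ p ∈ RST.closedUpperSheet B.q₀ \ RST.branchPoints B.q₀,
      p.zeta ∈ {z | z ≠ 0 ∧ 0 ≤ (RST.lamOf B.q₀ z).im ∧ RST.lamOf B.q₀ z ≠ 0} := fun p hp =>
    ⟨hz p, by rw [hl]; exact hp.1, by rw [hl]; exact RST.Surface.lam_ne_zero hp.2⟩
  have hL : ∀ p ∈ RST.closedLowerSheet B.q₀ \ RST.branchPoints B.q₀,
      p.zeta ∈ {z | z ≠ 0 ∧ 0 ≤ (-RST.lamOf B.q₀ z).im ∧ -RST.lamOf B.q₀ z ≠ 0} := fun p hp =>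
    ⟨hz p, by rw [hl, Complex.neg_im, neg_nonneg]; exact hp.1,
      by rw [hl]; exact neg_ne_zero.2 (RST.Surface.lam_ne_zero hp.2)⟩
  have hCU : RST.cut B.q₀ ⊆ RST.closedUpperSheet B.q₀ := fun p hp => (hcut p hp).ge
  have hCL : RST.cut B.q₀ ⊆ RST.closedLowerSheet B.q₀ := fun p hp => (hcut p hp).le
  have hU' : ∀ p ∈ RST.closedUpperSheet B.q₀,
      p.zeta ∈ {z | z ≠ 0 ∧ 0 ≤ (RST.lamOf B.q₀ z).im} := fun p hp =>
    ⟨hz p, by rw [hl]; exact hp⟩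
  have hL' : ∀ p ∈ RST.closedLowerSheet B.q₀,
      p.zeta ∈ {z | z ≠ 0 ∧ 0 ≤ (-RST.lamOf B.q₀ z).im} := fun p hp =>
    ⟨hz p, by rw [hl, Complex.neg_im, neg_nonneg]; exact hp⟩
  have hUo : ∀ p ∈ RST.upperSheet B.q₀, p.zeta ∈ {z | z ≠ 0 ∧ 0 < (RST.lamOf B.q₀ z).im} :=
    fun p hp => ⟨hz p, by rw [hl]; exact hp⟩
  have hLo : ∀ p ∈ RST.lowerSheet B.q₀, p.zeta ∈ {z | z ≠ 0 ∧ 0 < (-RST.lamOf B.q₀ z).im} :=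
    fun p hp => ⟨hz p, by rw [hl, Complex.neg_im, neg_pos]; exact hp⟩
  have hoU := RST.isOpen_im_pos (RST.differentiableOn_lamOf (q₀ := B.q₀))
  have hoL := RST.isOpen_im_pos (RST.differentiableOn_lamOf (q₀ := B.q₀)).fun_neg
  -- the Wronskians in the uniformizing coordinate
  obtain ⟨Wa, hWa⟩ : ∃ W : ℂ → ℂ, W = fun z =>
    RST.wronskian (RST.jostPhi B q t z) (RST.jostPsi B q t z) := ⟨_, rfl⟩
  obtain ⟨Wa', hWa'⟩ : ∃ W : ℂ → ℂ, W = fun z =>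
    -RST.wronskian (RST.jostPhiBar B q t z) (RST.jostPsiBar B q t z) := ⟨_, rfl⟩
  obtain ⟨Wb, hWb⟩ : ∃ W : ℂ → ℂ, W = fun z =>
    -RST.wronskian (RST.jostPhi B q t z) (RST.jostPsiBar B q t z) := ⟨_, rfl⟩
  obtain ⟨Wb', hWb'⟩ : ∃ W : ℂ → ℂ, W = fun z =>
    RST.wronskian (RST.jostPhiBar B q t z) (RST.jostPsi B q t z) := ⟨_, rfl⟩
  have ha₀ : ∀ p : RST.Surface B.q₀, p.lam ≠ 0 → 0 ≤ p.lam.im →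
      RST.a B q t p = Wa p.zeta / (2 * p.lam * p.zeta) := fun p h1 h2 => by
    rw [RST.a_eq hL1 h1 h2, hWa]
  have ha₀' : ∀ p : RST.Surface B.q₀, p.lam ≠ 0 → p.lam.im ≤ 0 →
      RST.aBar B q t p = Wa' p.zeta / (2 * p.lam * p.zeta) := fun p h1 h2 => by
    rw [RST.aBar_eq hL1 h1 h2, hWa']
  have hne : ∀ {A : Set (RST.Surface B.q₀)}, ∀ p ∈ A \ RST.branchPoints B.q₀, p.lam ≠ 0 :=
    fun p hp => RST.Surface.lam_ne_zero hp.2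
  have ha : ∀ p ∈ RST.closedUpperSheet B.q₀ \ RST.branchPoints B.q₀,
      RST.a B q t p = Wa p.zeta / (2 * p.lam * p.zeta) := fun p hp => ha₀ p (hne p hp) hp.1
  have ha' : ∀ p ∈ RST.closedLowerSheet B.q₀ \ RST.branchPoints B.q₀,
      RST.aBar B q t p = Wa' p.zeta / (2 * p.lam * p.zeta) := fun p hp => ha₀' p (hne p hp) hp.1
  have hb : ∀ p ∈ RST.cut B.q₀ \ RST.branchPoints B.q₀,
      RST.b B q t p = Wb p.zeta / (2 * p.lam * p.zeta) := fun p hp => by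
    rw [RST.b_eq hL1 (hne p hp) (hcut p hp.1), hWb]
  have hb' : ∀ p ∈ RST.cut B.q₀ \ RST.branchPoints B.q₀,
      RST.bBar B q t p = Wb' p.zeta / (2 * p.lam * p.zeta) := fun p hp => by
    rw [RST.bBar_eq hL1 (hne p hp) (hcut p hp.1), hWb']
  have hF : ∀ {A : Set (RST.Surface B.q₀)} {c : RST.Surface B.q₀ → ℂ} (W : ℂ → ℂ),
      (∀ p ∈ A \ RST.branchPoints B.q₀, c p = W p.zeta / (2 * p.lam * p.zeta)) →
      ∀ p ∈ A \ RST.branchPoints B.q₀, W p.zeta / (2 * p.zeta) = c p * p.lam :=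
    fun W hc p hp => RST.extension_eq hpos (hne p hp) (hc p hp)
  -- `b` and `b̄` pair an eigenfunction of the upper sheet with one of the lower sheet, so only the
  -- common domain `Im λ = 0` is available.
  have hCc : ∀ p ∈ RST.cut B.q₀ \ RST.branchPoints B.q₀, p.zeta ∈
      {z : ℂ | z ≠ 0 ∧ 0 ≤ (RST.lamOf B.q₀ z).im ∧ RST.lamOf B.q₀ z ≠ 0} ∩
        {z : ℂ | z ≠ 0 ∧ 0 ≤ (-RST.lamOf B.q₀ z).im ∧ -RST.lamOf B.q₀ z ≠ 0} := fun p hp =>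
    ⟨hU p ⟨hCU hp.1, hp.2⟩, hL p ⟨hCL hp.1, hp.2⟩⟩
  have hCc' : ∀ p ∈ RST.cut B.q₀, p.zeta ∈
      {z : ℂ | z ≠ 0 ∧ 0 ≤ (RST.lamOf B.q₀ z).im} ∩
        {z : ℂ | z ≠ 0 ∧ 0 ≤ (-RST.lamOf B.q₀ z).im} := fun p hp => ⟨hU' p (hCU hp), hL' p (hCL hp)⟩
  have ca : ContinuousOn Wa {z : ℂ | z ≠ 0 ∧ 0 ≤ (RST.lamOf B.q₀ z).im ∧ RST.lamOf B.q₀ z ≠ 0} :=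
    hWa ▸ RST.continuousOn_wronskian hφ.cont hψ.cont
  have ca' : ContinuousOn Wa'
      {z : ℂ | z ≠ 0 ∧ 0 ≤ (-RST.lamOf B.q₀ z).im ∧ -RST.lamOf B.q₀ z ≠ 0} :=
    hWa' ▸ (RST.continuousOn_wronskian hφ'.cont hψ'.cont).fun_neg
  have cb : ContinuousOn Wb
      ({z : ℂ | z ≠ 0 ∧ 0 ≤ (RST.lamOf B.q₀ z).im ∧ RST.lamOf B.q₀ z ≠ 0} ∩
        {z : ℂ | z ≠ 0 ∧ 0 ≤ (-RST.lamOf B.q₀ z).im ∧ -RST.lamOf B.q₀ z ≠ 0}) :=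
    hWb ▸ (RST.continuousOn_wronskian
      (hφ.cont.mono Set.inter_subset_left) (hψ'.cont.mono Set.inter_subset_right)).fun_neg
  have cb' : ContinuousOn Wb'
      ({z : ℂ | z ≠ 0 ∧ 0 ≤ (RST.lamOf B.q₀ z).im ∧ RST.lamOf B.q₀ z ≠ 0} ∩
        {z : ℂ | z ≠ 0 ∧ 0 ≤ (-RST.lamOf B.q₀ z).im ∧ -RST.lamOf B.q₀ z ≠ 0}) :=
    hWb' ▸ RST.continuousOn_wronskian
      (hφ'.cont.mono Set.inter_subset_right) (hψ.cont.mono Set.inter_subset_left)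
  have da : DifferentiableOn ℂ Wa {z : ℂ | z ≠ 0 ∧ 0 < (RST.lamOf B.q₀ z).im} :=
    hWa ▸ RST.differentiableOn_wronskian hφ.diff hψ.diff
  have da' : DifferentiableOn ℂ Wa' {z : ℂ | z ≠ 0 ∧ 0 < (-RST.lamOf B.q₀ z).im} :=
    hWa' ▸ (RST.differentiableOn_wronskian hφ'.diff hψ'.diff).fun_neg
  -- The unnamed extensions are determined by `hF`: each is `W(ζ)/(2ζ)`, the same function under
  -- both decay conditions.
  refine ⟨RST.scatteringDataWellDefined hL1, ⟨?_, fun p hp => ?_, ?_, fun p hp => ?_, ?_, ?_⟩,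
    fun h12 => ⟨⟨_, hF Wa ha, ?_, fun p hp => ?_⟩, ⟨_, hF Wa' ha', ?_, fun p hp => ?_⟩,
      ⟨_, hF Wb hb, ?_⟩, ⟨_, hF Wb' hb', ?_⟩⟩,
    fun hG => ⟨⟨_, hF Wa ha, fun p => ?_⟩, ⟨_, hF Wa' ha', fun p => ?_⟩,
      ⟨_, hF Wb hb, fun p => ?_⟩, ⟨_, hF Wb' hb', fun p => ?_⟩⟩⟩
  · exact RST.continuousOn_coefficient hpos ca hU hne ha
  · have h0 : p.lam ≠ 0 := fun h => by simp [RST.upperSheet, h] at hp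
    refine RST.analyticAtPoint_coefficient hpos hoU da (hUo p hp) h0 ?_
    -- Analyticity at `p` needs the Wronskian formula on a neighbourhood, which exists because the
    -- sheet is open.
    filter_upwards [(isOpen_lt continuous_const
      (Complex.continuous_im.comp RST.Surface.continuous_lam)).mem_nhds hp] with p' hp'
    exact ha₀ p' (fun h => by simp [h] at hp') (le_of_lt hp')
  · exact RST.continuousOn_coefficient hpos ca' hL hne ha'
  · have h0 : p.lam ≠ 0 := fun h => by simp [RST.lowerSheet, h] at hp
    refine RST.analyticAtPoint_coefficient hpos hoL da' (hLo p hp) h0 ?_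
    filter_upwards [(isOpen_lt (Complex.continuous_im.comp RST.Surface.continuous_lam)
      continuous_const).mem_nhds hp] with p' hp'
    exact ha₀' p' (fun h => by simp [h] at hp') (le_of_lt hp')
  · exact RST.continuousOn_coefficient hpos cb hCc hne hb
  · exact RST.continuousOn_coefficient hpos cb' hCc hne hb'
  · exact RST.continuousOn_extension hpos
      (hWa ▸ RST.continuousOn_wronskian (hφ.cont_weight h12) (hψ.cont_weight h12)) hU'
  · exact RST.analyticAtPoint_extension hpos hoU da (hUo p hp)
  · exact RST.continuousOn_extension hpos
      (hWa' ▸ (RST.continuousOn_wronskian (hφ'.cont_weight h12) (hψ'.cont_weight h12)).fun_neg) hL'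
  · exact RST.analyticAtPoint_extension hpos hoL da' (hLo p hp)
  · exact RST.continuousOn_extension hpos (hWb ▸ (RST.continuousOn_wronskian
      ((hφ.cont_weight h12).mono Set.inter_subset_left)
      ((hψ'.cont_weight h12).mono Set.inter_subset_right)).fun_neg) hCc'
  · exact RST.continuousOn_extension hpos (hWb' ▸ RST.continuousOn_wronskian
      ((hφ'.cont_weight h12).mono Set.inter_subset_right)
      ((hψ.cont_weight h12).mono Set.inter_subset_left)) hCc'
  -- Under Gaussian decay `W` is holomorphic on all of `ζ ≠ 0`, and every point of the surface has
  -- such a coordinate.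
  · exact RST.analyticAtPoint_extension hpos isOpen_compl_singleton (hWa ▸
      RST.differentiableOn_wronskian (hφ.diff_gaussian hG) (hψ.diff_gaussian hG)) (hz p)
  · exact RST.analyticAtPoint_extension hpos isOpen_compl_singleton (hWa' ▸
      (RST.differentiableOn_wronskian (hφ'.diff_gaussian hG) (hψ'.diff_gaussian hG)).fun_neg) (hz p)
  · exact RST.analyticAtPoint_extension hpos isOpen_compl_singleton (hWb ▸
      (RST.differentiableOn_wronskian (hφ.diff_gaussian hG) (hψ'.diff_gaussian hG)).fun_neg) (hz p)
  · exact RST.analyticAtPoint_extension hpos isOpen_compl_singleton (hWb' ▸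
      RST.differentiableOn_wronskian (hφ'.diff_gaussian hG) (hψ.diff_gaussian hG)) (hz p)
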